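/- Let $d\ge 1$ be an integer and $1\le p<\infty$. There is a real number $q>p$, depending only on $p$ and $d$, such that the following holds. Let $\Omega\subset\mathbb R^d$ be open, bounded, connected and polyhedral (that is, $\partial\Omega=\overline\Omega\setminus\Omega$ is a finite union of subsets of hyperplanes), and let $\eta>0$. Then there is a constant $C>0$, depending only on $d$, $\Omega$, $p$ and $\eta$, such that for every discretisation $\mathcal D=(\mathcal M,\mathcal E,\mathcal P)$ of $\Omega$ (as defined below) satisfying $$\eta\le \frac{d_{K,\sigma}}{d_{L,\sigma}}\le\frac1\eta\qquad\text{for all }\sigma\in\mathcal E\text{ with }\mathcal M_\sigma=\{K,L\},\ K\neq L,$$ and every function $u:\Omega\to\mathbb R$ that is (almost everywhere) equal to a constant $u_K$ on each $K\in\mathcal M$, $$\|u\|_{L^q(\Omega)}\le C\,\|u\|_{1,p,\mathcal M},\qquad \|u\|_{1,p,\mathcal M}^p=\sum_{K\in\mathcal M}\sum_{\sigma\in\mathcal E_K}|\sigma|\,d_{K,\sigma}\Big(\frac{D_\sigma u}{d_\sigma}\Big)^p .$$ Here $D_\sigma u=|u_K-u_L|$ and $d_\sigma=d_{K,\sigma}+d_{L,\sigma}$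 if $\mathcal M_\sigma=\{K,L\}$ with $K\ne L$, while $D_\sigma u=|u_K|$ and $d_\sigma=d_{K,\sigma}$ if $\mathcal M_\sigma=\{K\}$. A discretisation of $\Omega$ is a triple $(\mathcal M,\mathcal E,\mathcal P)$ as follows. (1) $\mathcal M$ is a finite family of nonempty connected open pairwise disjoint subsets of $\Omega$ (control volumes) with $\overline\Omega=\bigcup_{K\in\mathcal M}\overline K$; write $\partial K=\overline K\setminus K$. (2) $\mathcal E$ is a finite family of pairwise disjoint subsets of $\overline\Omega$ (edges); each $\sigma\in\mathcal E$ is a nonempty open subset of a hyperplane of $\mathbb R^d$, its $(d-1)$-dimensional measure $|\sigma|$ is positive, and its relative boundary $\overline\sigma\setminus\sigma$ has $(d-1)$-dimensional measure $0$. For each $K\in\mathcal M$ there is a subset $\mathcal E_K\subset\mathcal E$ with $\partial K=\bigcup_{\sigma\in\mathcal E_K}\overline\sigma$. For each $\sigma\in\mathcal E$, the set $\mathcal M_\sigma=\{K\in\mathcal M:\sigma\in\mathcal E_K\}$ either has exactly one element, and then $\sigma\subset\partial\Omega$, or has exactly two elements. (3) $\mathcal P=(x_K)_{K\in\mathcal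 M}$ is a family of points with $x_K\in K$ such that $K$ is star-shaped with respect to $x_K$, and for all $K\in\mathcal M$ and $\sigma\in\mathcal E_K$ the distance $d_{K,\sigma}$ from $x_K$ to the hyperplane containing $\sigma$ is positive. -/

import Mathlib

open MeasureTheory

noncomputable section

/-- A set is covered by finitely many hyperplanes of `ℝ^d`, i.e. it is a finite union of subsets of
hyperplanes. -/
def CoveredByHyperplanes {d : ℕ} (s : Set (EuclideanSpace ℝ (Fin d))) : Prop :=
  ∃ A : Finset (AffineSubspace ℝ (EuclideanSpace ℝ (Fin d))),
    (∀ H ∈ A, (H : Set (EuclideanSpace ℝ (Fin d))).Nonempty ∧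
      Module.finrank ℝ H.direction + 1 = d) ∧
    s ⊆ ⋃ H ∈ A, (H : Set (EuclideanSpace ℝ (Fin d)))

/-- A polyhedral open bounded connected subset of `ℝ^d`; the boundary of an open set `Ω` is
`closure Ω \ Ω`. -/
structure IsPolyhedralDomain {d : ℕ} (Ω : Set (EuclideanSpace ℝ (Fin d))) : Prop where
  isOpen : IsOpen Ω
  isBounded : Bornology.IsBounded Ω
  isConnected : IsConnected Ω
  polyhedral : CoveredByHyperplanes (closure Ω \ Ω)

/-- A space discretisation of `Ω`: control volumes, edges and cell points.
The hyperplane containing an edge `σ` is its affine span, and the `(d-1)`-dimensional measure of `σ`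
is `μHE[d - 1] σ` (Hausdorff measure normalised so as to agree with Lebesgue measure on
hyperplanes). -/
structure SpaceDiscretisation {d : ℕ} (Ω : Set (EuclideanSpace ℝ (Fin d))) where
  /-- the control volumes -/
  cells : Finset (Set (EuclideanSpace ℝ (Fin d)))
  cell_subset : ∀ K ∈ cells, K ⊆ Ω
  cell_isOpen : ∀ K ∈ cells, IsOpen K
  /-- nonempty and connected -/
  cell_isConnected : ∀ K ∈ cells, IsConnected K
  cells_disjoint : ∀ K ∈ cells, ∀ L ∈ cells, K ≠ L → Disjoint K L
  closure_eq : closure Ω = ⋃ K ∈ cells, closure K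
  /-- the edges -/
  edges : Finset (Set (EuclideanSpace ℝ (Fin d)))
  edge_subset : ∀ σ ∈ edges, σ ⊆ closure Ω
  edges_disjoint : ∀ σ ∈ edges, ∀ τ ∈ edges, σ ≠ τ → Disjoint σ τ
  edge_nonempty : ∀ σ ∈ edges, σ.Nonempty
  /-- the affine span of an edge is a hyperplane … -/
  edge_hyperplane : ∀ σ ∈ edges, Module.finrank ℝ (affineSpan ℝ σ).direction + 1 = d
  /-- … in which the edge is open -/
  edge_isOpen : ∀ σ ∈ edges, ∃ U : Set (EuclideanSpace ℝ (Fin d)), IsOpen U ∧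
    σ = U ∩ (affineSpan ℝ σ : Set (EuclideanSpace ℝ (Fin d)))
  edge_measure_pos : ∀ σ ∈ edges, 0 < μHE[d - 1] σ
  /-- the boundary of an edge inside its hyperplane is negligible (as for every polyhedral edge) -/
  edge_boundary_null : ∀ σ ∈ edges, μHE[d - 1] (closure σ \ σ) = 0
  /-- the set of edges of a control volume -/
  edgesOf : Set (EuclideanSpace ℝ (Fin d)) → Finset (Set (EuclideanSpace ℝ (Fin d)))
  edgesOf_subset : ∀ K ∈ cells, edgesOf K ⊆ edges
  cell_boundary : ∀ K ∈ cells, closure K \ K = ⋃ σ ∈ edgesOf K, closure σ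
  /-- every edge is a boundary interface or an interior interface -/
  edge_cells : ∀ σ ∈ edges,
    ({K | K ∈ cells ∧ σ ∈ edgesOf K}.ncard = 1 ∧ σ ⊆ closure Ω \ Ω) ∨
      {K | K ∈ cells ∧ σ ∈ edgesOf K}.ncard = 2
  /-- the point `x_K` of a control volume -/
  center : Set (EuclideanSpace ℝ (Fin d)) → EuclideanSpace ℝ (Fin d)
  center_mem : ∀ K ∈ cells, center K ∈ K
  cell_starConvex : ∀ K ∈ cells, StarConvex ℝ (center K) K
  center_dist_pos : ∀ K ∈ cells, ∀ σ ∈ edgesOf K,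
    0 < Metric.infDist (center K) (affineSpan ℝ σ : Set (EuclideanSpace ℝ (Fin d)))

namespace SpaceDiscretisation

variable {d : ℕ} {Ω : Set (EuclideanSpace ℝ (Fin d))}

open Classical in
/-- `M_σ`: the control volumes that have `σ` as an edge. -/
def cellsOf (D : SpaceDiscretisation Ω) (σ : Set (EuclideanSpace ℝ (Fin d))) :
    Finset (Set (EuclideanSpace ℝ (Fin d))) :=
  D.cells.filter (fun K => σ ∈ D.edgesOf K)

/-- `d_{K,σ}`: the Euclidean distance from `x_K` to the hyperplane containing `σ`. -/
def cellDist (D : SpaceDiscretisation Ω) (K σ : Set (EuclideanSpace ℝ (Fin d))) : ℝ :=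
  Metric.infDist (D.center K) (affineSpan ℝ σ : Set (EuclideanSpace ℝ (Fin d)))

/-- `d_σ`, which is `d_{K,σ} + d_{L,σ}` if `M_σ = {K, L}` and `d_{K,σ}` if `M_σ = {K}`. -/
def edgeDist (D : SpaceDiscretisation Ω) (σ : Set (EuclideanSpace ℝ (Fin d))) : ℝ :=
  ∑ K ∈ D.cellsOf σ, D.cellDist K σ

open Classical in
/-- `D_σ v` for cell values `v`, seen from a control volume `K ∈ M_σ`: it is `|v_K - v_L|` if
`M_σ = {K, L}` and `|v_K|` if `M_σ = {K}`. -/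
def jump (D : SpaceDiscretisation Ω) (v : Set (EuclideanSpace ℝ (Fin d)) → ℝ)
    (K σ : Set (EuclideanSpace ℝ (Fin d))) : ℝ :=
  |v K - ∑ L ∈ (D.cellsOf σ).erase K, v L|

/-- The discrete `W^{1,p}` norm of the piecewise constant function with cell values `v`. -/
def discreteNorm (D : SpaceDiscretisation Ω) (p : ℝ)
    (v : Set (EuclideanSpace ℝ (Fin d)) → ℝ) : ℝ :=
  (∑ K ∈ D.cells, ∑ σ ∈ D.edgesOf K,
    (μHE[d - 1] σ).toReal * D.cellDist K σ * (D.jump v K σ / D.edgeDist σ) ^ p) ^ (1 / p)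

/-- `u` is the piecewise constant function whose value on each control volume `K` is `v K`
(almost everywhere). Only the values of `v` on control volumes matter. -/
def HasCellValues (D : SpaceDiscretisation Ω) (u : EuclideanSpace ℝ (Fin d) → ℝ)
    (v : Set (EuclideanSpace ℝ (Fin d)) → ℝ) : Prop :=
  ∀ K ∈ D.cells, ∀ᵐ x ∂(volume.restrict K), u x = v K

/-- The mesh ratio bound `η ≤ d_{K,σ} / d_{L,σ} ≤ 1 / η` on every interior interface. -/
def RatioBound (D : SpaceDiscretisation Ω) (η : ℝ) : Prop :=
  ∀ σ ∈ D.edges, ∀ K ∈ D.cellsOf σ, ∀ L ∈ D.cellsOf σ, K ≠ L →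
    η ≤ D.cellDist K σ / D.cellDist L σ ∧ D.cellDist K σ / D.cellDist L σ ≤ 1 / η

end SpaceDiscretisation

end

/-!
Let `w` be the piecewise constant function with cell values `|v_K| ^ p`, extended by zero, and let
`T` be its total variation. A generic segment from `x` to `x + h` sees a jump of `w` only where it
crosses an edge, and the set of `x` for which it crosses `σ` has volume at most `‖h‖ |σ|`; hence
`∫ |w (x + h) - w x| dx ≤ ‖h‖ T`.

The cones over the edges of `K` with apex `x_K` are disjoint and contained in `K`, so
`∑ σ, |σ| d_{K,σ} ≤ d |K|`. With Hölder's inequality and the mesh ratio bound this gives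
`T ≤ M ‖v‖_p ^ (p - 1) N`, where `N` is the discrete `W^{1,p}` norm. If `Ω` lies in a ball of
radius `R`, translating `w` by a vector of length `2 R` gives `‖v‖_p ^ p ≤ 2 R T`, hence a discrete
Poincaré inequality and `T ≤ B N ^ p`.

Averaging `|w (x + h) - w x|` over a ball of vectors `h` whose volume is of order `T / t` gives the
weak-type bound `|{t < w}| ≤ A (T / t) ^ (1 + 1 / d)`, and then `∫ w ^ r ≤ C T ^ r` for every
exponent `r < 1 + 1 / d`. The theorem follows with `q = p r`, `1 < r < 1 + 1 / d`.
-/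

/-! ### Hyperplanes and cones -/

/-- A hyperplane: a nonempty affine subspace whose direction has codimension one. -/
structure IsHyperplane {E : Type*} [NormedAddCommGroup E] [InnerProductSpace ℝ E]
    (H : AffineSubspace ℝ E) : Prop where
  nonempty : (H : Set E).Nonempty
  finrank_direction_add_one : Module.finrank ℝ H.direction + 1 = Module.finrank ℝ E

/-- The open cone with apex `x` and base `N`, without its apex and its base. -/
def openCone {E : Type*} [NormedAddCommGroup E] [InnerProductSpace ℝ E] (x : E) (N : Set E) :
    Set E :=
  {z | ∃ y ∈ N, ∃ r ∈ Set.Ioo (0 : ℝ) 1, AffineMap.lineMap x y r = z}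

section Hyperplanes

open Filter Topology

variable {E : Type*} [NormedAddCommGroup E] [InnerProductSpace ℝ E]
  {H : AffineSubspace ℝ E}

lemma IsHyperplane.sSameSide_iff (hH : IsHyperplane H) {ν : E} {c : ℝ}
    (hν : ∀ x, x ∈ H ↔ inner ℝ ν x = c) {x y : E} :
    H.SSameSide x y ↔ 0 < (inner ℝ ν x - c) * (inner ℝ ν y - c) := by
  obtain ⟨p, hp⟩ := hH.nonempty
  have hp' := (hν p).1 hp
  rw [AffineSubspace.sSameSide_iff_exists_left hp, hν, hν]
  constructor
  · rintro ⟨hx, hy, q, hq, hray⟩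
    have hxp : x -ᵥ p ≠ 0 := vsub_ne_zero.2 fun h => hx (h ▸ hp')
    have hyq : y -ᵥ q ≠ 0 := vsub_ne_zero.2 fun h => hy (h ▸ (hν q).1 hq)
    obtain ⟨a, b, ha, hb, hab⟩ := hray.exists_pos hxp hyq
    have hab' : a * (inner ℝ ν x - c) = b * (inner ℝ ν y - c) := by
      simpa [inner_smul_right, inner_sub_right, hp', (hν q).1 hq] using
        congrArg (inner ℝ ν) hab
    have : 0 < a * b * ((inner ℝ ν x - c) * (inner ℝ ν y - c)) := by
      calc 0 < (b * (inner ℝ ν y - c)) ^ 2 := by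
            have := sub_ne_zero.2 hy; positivity
        _ = a * b * ((inner ℝ ν x - c) * (inner ℝ ν y - c)) := by rw [sq]; nth_rw 1 [← hab']; ring
    exact pos_of_mul_pos_right this (by positivity)
  · intro hpos
    have hx := left_ne_zero_of_mul hpos.ne'
    have hy := right_ne_zero_of_mul hpos.ne'
    refine ⟨sub_ne_zero.1 hx, sub_ne_zero.1 hy,
      y - ((inner ℝ ν y - c) / (inner ℝ ν x - c)) • (x - p), ?_, ?_⟩
    · rw [hν, inner_sub_right, inner_smul_right, inner_sub_right, hp', div_mul_cancel₀ _ hx]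
      ring
    · rw [vsub_eq_sub, vsub_eq_sub, sub_sub_cancel]
      refine SameRay.rfl.nonneg_smul_right ?_
      rcases pos_and_pos_or_neg_and_neg_of_mul_pos hpos with ⟨h₁, h₂⟩ | ⟨h₁, h₂⟩
      · exact (div_pos h₂ h₁).le
      · exact (div_pos_of_neg_of_neg h₂ h₁).le

lemma openCone_eq_of_inner_eq {x w : E} (hw0 : w ≠ 0) {N : Set E}
    (hw : ∀ y ∈ N, inner ℝ w (y - x) = ‖w‖ ^ 2) :
    openCone x N = {z | inner ℝ w (z - x) / ‖w‖ ^ 2 ∈ Set.Ioo (0 : ℝ) 1 ∧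
      AffineMap.lineMap x z (inner ℝ w (z - x) / ‖w‖ ^ 2)⁻¹ ∈ N} := by
  have hw2 : ‖w‖ ^ 2 ≠ 0 := by simpa using hw0
  ext z
  constructor
  · rintro ⟨y, hy, r, hr, rfl⟩
    have : inner ℝ w (AffineMap.lineMap x y r - x) / ‖w‖ ^ 2 = r := by
      rw [AffineMap.lineMap_apply_module', add_sub_cancel_right, inner_smul_right, hw y hy,
        mul_div_cancel_right₀ _ hw2]
    rw [Set.mem_ofPred_eq, this, AffineMap.lineMap_lineMap_right, inv_mul_cancel₀ hr.1.ne',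
      AffineMap.lineMap_apply_one]
    exact ⟨hr, hy⟩
  · rintro ⟨hr, hz⟩
    refine ⟨_, hz, _, hr, ?_⟩
    rw [AffineMap.lineMap_lineMap_right, mul_inv_cancel₀ hr.1.ne', AffineMap.lineMap_apply_one]

lemma inter_slice_openCone {x w : E} (hw0 : w ≠ 0) {N : Set E}
    (hw : ∀ y ∈ N, inner ℝ w (y - x) = ‖w‖ ^ 2) (r : ℝ) :
    openCone x N ∩ {z | inner ℝ w (z - x) = r * ‖w‖ ^ 2} =
      {z | r ∈ Set.Ioo (0 : ℝ) 1 ∧ z ∈ AffineMap.homothety x r '' N} := by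
  have hinner (s : ℝ) {y : E} (hy : y ∈ N) :
      inner ℝ w (AffineMap.lineMap x y s - x) = s * ‖w‖ ^ 2 := by
    rw [AffineMap.lineMap_apply_module', add_sub_cancel_right, inner_smul_right, hw y hy]
  ext z
  constructor
  · rintro ⟨⟨y, hy, s, hs, rfl⟩, hz⟩
    obtain rfl : s = r :=
      mul_right_cancel₀ (by simpa using hw0 : ‖w‖ ^ 2 ≠ 0) ((hinner s hy).symm.trans hz)
    exact ⟨hs, y, hy, rfl⟩
  · rintro ⟨hr, y, hy, rfl⟩
    exact ⟨⟨y, hy, r, hr, rfl⟩, hinner r hy⟩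

lemma setOf_exists_add_smul_mem_eq {p ν h : E} (hνh : inner ℝ ν h ≠ 0) {N : Set E}
    (hN : ∀ y ∈ N, inner ℝ ν (y - p) = 0) (I : Set ℝ) :
    {x | ∃ s ∈ I, x + s • h ∈ N} = {x | -inner ℝ ν (x - p) / inner ℝ ν h ∈ I ∧
      x + (-inner ℝ ν (x - p) / inner ℝ ν h) • h ∈ N} := by
  ext x
  refine ⟨fun ⟨s, hs, hx⟩ => ?_, fun hx => ⟨_, hx⟩⟩
  have hxs := hN _ hx
  rw [add_sub_right_comm, inner_add_right, inner_smul_right] at hxs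
  obtain rfl : s = -inner ℝ ν (x - p) / inner ℝ ν h := by
    rw [eq_div_iff hνh]; linarith
  exact ⟨hs, hx⟩

variable [FiniteDimensional ℝ E]

lemma IsHyperplane.mem_iff_inner_sub_eq_zero (hH : IsHyperplane H) {p v : E} (hp : p ∈ H)
    (hv : v ∈ H.directionᗮ) (hv0 : v ≠ 0) {x : E} : x ∈ H ↔ inner ℝ v (x - p) = 0 := by
  have hrank : Module.finrank ℝ H.directionᗮ = 1 := by
    have := H.direction.finrank_add_finrank_orthogonal
    have := hH.finrank_direction_add_one
    omega
  have hspan : ℝ ∙ v = H.directionᗮ :=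
    Submodule.eq_of_le_of_finrank_eq ((Submodule.span_singleton_le_iff_mem v _).2 hv)
      (by rw [hrank, finrank_span_singleton hv0])
  rw [← AffineSubspace.vsub_right_mem_direction_iff_mem hp,
    ← Submodule.orthogonal_orthogonal H.direction, ← hspan,
    Submodule.mem_orthogonal_singleton_iff_inner_right, vsub_eq_sub]

lemma IsHyperplane.exists_normal (hH : IsHyperplane H) :
    ∃ (ν : E) (c : ℝ), ν ≠ 0 ∧ ∀ x, x ∈ H ↔ inner ℝ ν x = c := by
  obtain ⟨p, hp⟩ := hH.nonempty
  have hdir : H.directionᗮ ≠ ⊥ := by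
    rw [ne_eq, Submodule.orthogonal_eq_bot_iff]
    intro h
    have := hH.finrank_direction_add_one
    rw [h, finrank_top] at this
    omega
  obtain ⟨ν, hν, hν0⟩ := Submodule.exists_mem_ne_zero_of_ne_bot hdir
  refine ⟨ν, inner ℝ ν p, hν0, fun x => ?_⟩
  rw [hH.mem_iff_inner_sub_eq_zero hp hν hν0, inner_sub_right, sub_eq_zero]

lemma IsHyperplane.exists_normal_of_notMem (hH : IsHyperplane H) {x : E} (hx : x ∉ H) :
    ∃ w : E, w ≠ 0 ∧ ‖w‖ = Metric.infDist x H ∧ ∀ y, y ∈ H ↔ inner ℝ w (y - x) = ‖w‖ ^ 2 := by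
  have : Nonempty H := hH.nonempty.to_subtype
  obtain ⟨p, hp⟩ : ∃ p : E, p = EuclideanGeometry.orthogonalProjection H x := ⟨_, rfl⟩
  have hpH : p ∈ H := hp ▸ EuclideanGeometry.orthogonalProjection_mem x
  have hw0 : p - x ≠ 0 := sub_ne_zero.2 fun h => hx (h ▸ hpH)
  refine ⟨p - x, hw0, ?_, fun y => ?_⟩
  · rw [← EuclideanGeometry.dist_orthogonalProjection_eq_infDist, ← hp, dist_eq_norm,
      norm_sub_rev]
  · rw [hH.mem_iff_inner_sub_eq_zero hpH
      (hp ▸ EuclideanGeometry.orthogonalProjection_vsub_mem_direction_orthogonal H x) hw0,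
      ← real_inner_self_eq_norm_sq, ← sub_eq_zero (a := inner ℝ (p - x) (y - x)),
      ← inner_sub_right, sub_sub_sub_cancel_right]

lemma IsHyperplane.eq_of_add_smul_mem (hH : IsHyperplane H) {x h : E} (hx : x ∉ H) {s t : ℝ}
    (hs : x + s • h ∈ H) (ht : x + t • h ∈ H) : s = t := by
  obtain ⟨ν, c, -, hν⟩ := hH.exists_normal
  simp only [hν, inner_add_right, inner_smul_right] at hx hs ht
  have hh : inner ℝ ν h ≠ 0 := fun h0 => hx (by simpa [h0] using hs)
  exact mul_right_cancel₀ hh (by linarith)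

lemma IsHyperplane.sSameSide_or_sSameSide (hH : IsHyperplane H) {x y z : E} (hx : x ∉ H)
    (hy : y ∉ H) (hz : z ∉ H) (hxy : ¬ H.SSameSide x y) : H.SSameSide x z ∨ H.SSameSide y z := by
  obtain ⟨ν, c, -, hν⟩ := hH.exists_normal
  simp only [hH.sSameSide_iff hν, hν, ← sub_ne_zero (b := c), not_lt] at *
  rcases hx.lt_or_gt with hx | hx <;> rcases hy.lt_or_gt with hy | hy <;>
    rcases hz.lt_or_gt with hz | hz <;> first
    | exact Or.inl (by nlinarith)
    | exact Or.inr (by nlinarith)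

/-- The radial projection from `x` to `H` is continuous at `z` and fixes it, hence maps points
near `z` into `U ∩ H`. -/
lemma IsHyperplane.eventually_mem_openCone (hH : IsHyperplane H) {x z : E} (hx : x ∉ H)
    (hz : z ∈ H) {U : Set E} (hU : U ∈ 𝓝 z) :
    ∀ᶠ y in 𝓝 z, H.SSameSide x y → y ∈ openCone x (U ∩ H) := by
  obtain ⟨w, hw0, -, hw⟩ := hH.exists_normal_of_notMem hx
  have hw2 : ‖w‖ ^ 2 ≠ 0 := by simpa using hw0
  let r : E → ℝ := fun y => inner ℝ w (y - x) / ‖w‖ ^ 2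
  have hr : Continuous r := by fun_prop
  have hrz : r z = 1 := by simp only [r, (hw z).1 hz, div_self hw2]
  have hproj : Tendsto (fun y => AffineMap.lineMap x y (r y)⁻¹) (𝓝 z) (𝓝 z) := by
    have : ContinuousAt (fun y => (r y)⁻¹ • (y - x) + x) z := by
      exact ((hr.continuousAt.inv₀ (hrz ▸ one_ne_zero)).smul (by fun_prop)).add_const x
    simpa [ContinuousAt, AffineMap.lineMap_apply, hrz] using this
  filter_upwards [hproj.eventually_mem hU, hr.continuousAt.eventually_const_lt (hrz ▸ one_pos)]
    with y hyU hry hxy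
  refine ⟨_, ⟨hyU, (hw _).2 ?_⟩, r y, ⟨hry, ?_⟩, ?_⟩
  · rw [AffineMap.lineMap_apply_module', add_sub_cancel_right, inner_smul_right]
    exact (inv_mul_eq_iff_eq_mul₀ hry.ne').2 (div_mul_cancel₀ _ hw2).symm
  · have hw' : ∀ u, u ∈ H ↔ inner ℝ w u = ‖w‖ ^ 2 + inner ℝ w x := fun u => by
      rw [hw, inner_sub_right, sub_eq_iff_eq_add]
    have := (hH.sSameSide_iff hw').1 hxy
    rw [div_lt_one (by positivity), inner_sub_right]
    nlinarith [sq_pos_of_pos (norm_pos_iff.2 hw0)]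
  · rw [AffineMap.lineMap_lineMap_right, mul_inv_cancel₀ hry.ne', AffineMap.lineMap_apply_one]

variable [MeasurableSpace E] [BorelSpace E]

lemma volume_eq_enorm_mul_lintegral_slices (p : E) {v : E} (hv : v ≠ 0) {A : Set E}
    (hA : MeasurableSet A) :
    volume A = ‖v‖ₑ *
      ∫⁻ t : ℝ, μHE[Module.finrank ℝ E - 1] (A ∩ {x | inner ℝ v (x - p) = t * ‖v‖ ^ 2}) := by
  have hslice (t : ℝ) : {x | inner ℝ v (x - p) = t * ‖v‖ ^ 2} =
      (AffineSubspace.mk' (t • v +ᵥ p) (ℝ ∙ v)ᗮ : Set E) := by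
    ext x
    simp only [SetLike.mem_coe, AffineSubspace.mem_mk', vsub_eq_sub, vadd_eq_add,
      Submodule.mem_orthogonal_singleton_iff_inner_right, Set.mem_ofPred_eq, inner_sub_right,
      inner_add_right, inner_smul_right, real_inner_self_eq_norm_sq]
    constructor <;> intro h <;> linarith
  simp only [hslice]
  rw [← InnerProductSpace.euclideanHausdorffMeasure_eq_volume,
    EuclideanGeometry.euclideanHausdorffMeasure_eq_lintegral p hv hA]

lemma IsHyperplane.volume_eq_zero (hH : IsHyperplane H) : volume (H : Set E) = 0 := by
  refine Measure.addHaar_affineSubspace volume H fun h => ?_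
  have := hH.finrank_direction_add_one
  rw [h, AffineSubspace.direction_top, finrank_top] at this
  omega

lemma IsHyperplane.measurableSet_openCone (hH : IsHyperplane H) {x : E} (hx : x ∉ H) {N : Set E}
    (hN : MeasurableSet N) (hNH : N ⊆ H) : MeasurableSet (openCone x N) := by
  obtain ⟨w, hw0, -, hw⟩ := hH.exists_normal_of_notMem hx
  have hr : Measurable fun z : E => inner ℝ w (z - x) / ‖w‖ ^ 2 := by fun_prop
  have hproj : Measurable fun z : E =>
      AffineMap.lineMap x z (inner ℝ w (z - x) / ‖w‖ ^ 2)⁻¹ := by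
    simp only [AffineMap.lineMap_apply_module']
    exact (hr.inv.smul (by fun_prop)).add_const x
  rw [openCone_eq_of_inner_eq hw0 fun y hy => (hw y).1 (hNH hy)]
  exact (hr measurableSet_Ioo).inter (hproj hN)

lemma lintegral_Ioo_ofReal_pow (n : ℕ) :
    ∫⁻ r in Set.Ioo (0 : ℝ) 1, ENNReal.ofReal r ^ n = ((n : ENNReal) + 1)⁻¹ := by
  have hpow : ∀ r ∈ Set.Ioo (0 : ℝ) 1, ENNReal.ofReal r ^ n = ENNReal.ofReal (r ^ n) :=
    fun r hr => (ENNReal.ofReal_pow hr.1.le n).symm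
  have hint : IntegrableOn (fun r : ℝ => r ^ n) (Set.Ioo 0 1) :=
    ((continuous_pow n).integrableOn_Icc).mono_set Set.Ioo_subset_Icc_self
  rw [setLIntegral_congr_fun measurableSet_Ioo hpow, ← ofReal_integral_eq_lintegral_ofReal hint
    ((ae_restrict_mem measurableSet_Ioo).mono fun r hr => pow_nonneg hr.1.le n),
    ← integral_Ioc_eq_integral_Ioo, ← intervalIntegral.integral_of_le zero_le_one, integral_pow,
    one_pow, zero_pow n.succ_ne_zero, sub_zero, one_div,
    ENNReal.ofReal_inv_of_pos n.cast_add_one_pos]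
  norm_cast

lemma IsHyperplane.finrank_mul_volume_openCone (hH : IsHyperplane H) {x : E} (hx : x ∉ H)
    {N : Set E} (hN : MeasurableSet N) (hNH : N ⊆ H) :
    Module.finrank ℝ E * volume (openCone x N) =
      ENNReal.ofReal (Metric.infDist x H) * μHE[Module.finrank ℝ E - 1] N := by
  obtain ⟨w, hw0, hwd, hw⟩ := hH.exists_normal_of_notMem hx
  obtain ⟨n, hn⟩ : ∃ n, n + 1 = Module.finrank ℝ E := ⟨_, hH.finrank_direction_add_one⟩
  have hslice (r : ℝ) :
      μHE[n] (openCone x N ∩ {z | inner ℝ w (z - x) = r * ‖w‖ ^ 2}) =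
        (Set.Ioo 0 1).indicator (fun r => ENNReal.ofReal r ^ n * μHE[n] N) r := by
    rw [inter_slice_openCone hw0 fun y hy => (hw y).1 (hNH hy)]
    by_cases hr : r ∈ Set.Ioo (0 : ℝ) 1
    · simp only [hr, true_and, Set.ofPred_mem_eq, Set.indicator_of_mem hr]
      rw [euclideanHausdorffMeasure_homothety_image n x hr.1.ne', ENNReal.smul_def, smul_eq_mul,
        ENNReal.coe_pow, ← enorm_eq_nnnorm, Real.enorm_of_nonneg hr.1.le]
    · simp only [hr, false_and, Set.ofPred_false, measure_empty, Set.indicator_of_notMem hr]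
  rw [volume_eq_enorm_mul_lintegral_slices x hw0 (hH.measurableSet_openCone hx hN hNH), ← hn,
    Nat.add_sub_cancel]
  simp only [hslice]
  rw [lintegral_indicator measurableSet_Ioo, lintegral_mul_const _ (by fun_prop),
    lintegral_Ioo_ofReal_pow, ← ofReal_norm, hwd, Nat.cast_add, Nat.cast_one]
  calc _ = ((n : ENNReal) + 1) * ((n : ENNReal) + 1)⁻¹ *
        (ENNReal.ofReal (Metric.infDist x H) * μHE[n] N) := by ring
    _ = _ := by rw [ENNReal.mul_inv_cancel (by simp) (by finiteness), one_mul]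

lemma measurableSet_setOf_exists_add_smul_mem {p ν h : E} (hνh : inner ℝ ν h ≠ 0) {N : Set E}
    (hN : MeasurableSet N) (hNν : ∀ y ∈ N, inner ℝ ν (y - p) = 0) {I : Set ℝ}
    (hI : MeasurableSet I) : MeasurableSet {x | ∃ s ∈ I, x + s • h ∈ N} := by
  have htime : Measurable fun x : E => -inner ℝ ν (x - p) / inner ℝ ν h := by fun_prop
  rw [setOf_exists_add_smul_mem_eq hνh hNν]
  exact (htime hI).inter ((measurable_id.add (htime.smul_const h)) hN)

lemma volume_setOf_exists_add_smul_mem_le_of_inner_ne_zero {p ν h : E} (hνh : inner ℝ ν h ≠ 0)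
    {N : Set E} (hN : MeasurableSet N) (hNν : ∀ y ∈ N, inner ℝ ν (y - p) = 0) {I : Set ℝ}
    (hI : MeasurableSet I) :
    volume {x | ∃ s ∈ I, x + s • h ∈ N} ≤
      volume I * ENNReal.ofReal ‖h‖ * μHE[Module.finrank ℝ E - 1] N := by
  have hν : ν ≠ 0 := fun h0 => hνh (by rw [h0, inner_zero_left])
  let κ : ℝ := -(‖ν‖ ^ 2 / inner ℝ ν h)
  have hκ : κ ≠ 0 := neg_ne_zero.2 (div_ne_zero (by simpa using hν) hνh)
  have hslice (t : ℝ) : μHE[Module.finrank ℝ E - 1]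
      ({x | ∃ s ∈ I, x + s • h ∈ N} ∩ {x | inner ℝ ν (x - p) = t * ‖ν‖ ^ 2}) ≤
        ((κ * ·) ⁻¹' I).indicator (fun _ => μHE[Module.finrank ℝ E - 1] N) t := by
    have hsub : {x | ∃ s ∈ I, x + s • h ∈ N} ∩ {x | inner ℝ ν (x - p) = t * ‖ν‖ ^ 2} ⊆
        {x | κ * t ∈ I ∧ x + (κ * t) • h ∈ N} := by
      rw [setOf_exists_add_smul_mem_eq hνh hNν]
      rintro x ⟨hx, hxt⟩
      have hκt : -inner ℝ ν (x - p) / inner ℝ ν h = κ * t := by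
        rw [show inner ℝ ν (x - p) = t * ‖ν‖ ^ 2 from hxt]; ring
      rwa [Set.mem_ofPred_eq, hκt] at hx
    refine (measure_mono hsub).trans ?_
    by_cases ht : κ * t ∈ I
    · rw [Set.indicator_of_mem (by exact ht)]
      simp only [ht, true_and]
      exact (measure_preimage_add_right _ _ _).le
    · simp only [ht, false_and, Set.ofPred_false, measure_empty, zero_le]
  calc volume {x | ∃ s ∈ I, x + s • h ∈ N}
      ≤ ‖ν‖ₑ * ∫⁻ t, ((κ * ·) ⁻¹' I).indicator (fun _ => μHE[Module.finrank ℝ E - 1] N) t := by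
        rw [volume_eq_enorm_mul_lintegral_slices p hν
          (measurableSet_setOf_exists_add_smul_mem hνh hN hNν hI)]
        gcongr with t
        exact hslice t
    _ = volume I * (‖ν‖ₑ * ENNReal.ofReal |κ⁻¹|) * μHE[Module.finrank ℝ E - 1] N := by
        rw [lintegral_indicator_const (hI.preimage (measurable_const_mul κ)),
          Real.volume_preimage_mul_left hκ]
        ring
    _ ≤ volume I * ENNReal.ofReal ‖h‖ * μHE[Module.finrank ℝ E - 1] N := by
        gcongr
        rw [← ofReal_norm, ← ENNReal.ofReal_mul (norm_nonneg ν), inv_neg, abs_neg, inv_div,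
          abs_div, abs_pow, abs_norm]
        refine ENNReal.ofReal_le_ofReal ?_
        have hν0 : 0 < ‖ν‖ := norm_pos_iff.2 hν
        rw [mul_div_assoc', div_le_iff₀ (by positivity), sq, mul_left_comm]
        exact mul_le_mul_of_nonneg_left
          ((abs_real_inner_le_norm ν h).trans_eq (mul_comm _ _)) hν0.le

lemma IsHyperplane.volume_setOf_exists_add_smul_mem_le (hH : IsHyperplane H) {N : Set E}
    (hN : MeasurableSet N) (hNH : N ⊆ H) {I : Set ℝ} (hI : MeasurableSet I) (h : E) :
    volume {x | ∃ s ∈ I, x + s • h ∈ N} ≤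
      volume I * ENNReal.ofReal ‖h‖ * μHE[Module.finrank ℝ E - 1] N := by
  obtain ⟨p, hp⟩ := hH.nonempty
  obtain ⟨ν, c, -, hν⟩ := hH.exists_normal
  have hνp (y : E) : y ∈ H ↔ inner ℝ ν (y - p) = 0 := by
    rw [hν, inner_sub_right, (hν p).1 hp, sub_eq_zero]
  by_cases hνh : inner ℝ ν h = 0
  · refine (measure_mono_null ?_ hH.volume_eq_zero).trans_le zero_le
    rintro x ⟨s, -, hs⟩
    simpa [hν, inner_add_right, inner_smul_right, hνh] using hNH hs
  · exact volume_setOf_exists_add_smul_mem_le_of_inner_ne_zero hνh hN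
      (fun y hy => (hνp y).1 (hNH hy)) hI

/-- A line in direction `h` that meets a subspace of codimension two lies in the span of that
subspace and `h`. -/
lemma volume_setOf_exists_add_smul_mem_eq_zero {A : AffineSubspace ℝ E} {p : E} (hp : p ∈ A)
    (hA : Module.finrank ℝ A.direction + 2 ≤ Module.finrank ℝ E) (h : E) :
    volume {x | ∃ s : ℝ, x + s • h ∈ A} = 0 := by
  refine measure_mono_null (t := AffineSubspace.mk' p (A.direction ⊔ ℝ ∙ h)) ?_
    (Measure.addHaar_affineSubspace volume _ fun htop => ?_)
  · rintro x ⟨s, hs⟩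
    have hxs : x -ᵥ p = (x + s • h -ᵥ p) + (-s) • h := by
      simp only [vsub_eq_sub, neg_smul]; abel
    rw [SetLike.mem_coe, AffineSubspace.mem_mk', hxs]
    exact Submodule.add_mem_sup (AffineSubspace.vsub_mem_direction hs hp)
      (Submodule.smul_mem _ _ (Submodule.mem_span_singleton_self h))
  · have hdir : A.direction ⊔ ℝ ∙ h = ⊤ := by
      rw [← AffineSubspace.direction_mk' p (A.direction ⊔ ℝ ∙ h), htop,
        AffineSubspace.direction_top]
    have := Submodule.finrank_add_le_finrank_add_finrank A.direction (ℝ ∙ h)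
    rw [hdir, finrank_top] at this
    have : Module.finrank ℝ (ℝ ∙ h) ≤ 1 := by simpa using finrank_span_le_card ({h} : Set E)
    omega

lemma IsHyperplane.volume_setOf_exists_add_smul_mem_inf_eq_zero {H' : AffineSubspace ℝ E}
    (hH : IsHyperplane H) (hH' : IsHyperplane H') (hne : H ≠ H') (h : E) :
    volume {x | ∃ s : ℝ, x + s • h ∈ H ⊓ H'} = 0 := by
  rcases (H ⊓ H').eq_bot_or_nonempty with hbot | ⟨p, hp⟩
  · simp [hbot, AffineSubspace.notMem_bot]
  refine volume_setOf_exists_add_smul_mem_eq_zero hp ?_ h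
  have hrank := hH.finrank_direction_add_one
  have hrank' := hH'.finrank_direction_add_one
  have hlt : (H ⊓ H').direction < H.direction := by
    refine lt_of_le_of_ne (AffineSubspace.direction_le inf_le_left) fun heq => hne ?_
    have hle : H.direction ≤ H'.direction :=
      heq ▸ AffineSubspace.direction_le (inf_le_right : H ⊓ H' ≤ H')
    exact AffineSubspace.ext_of_direction_eq
      (Submodule.eq_of_le_of_finrank_eq hle (by omega)) ⟨p, hp⟩
  have := Submodule.finrank_lt_finrank_of_lt hlt
  omega

end Hyperplanes

/-! ### Inequalities for finitely many jumps and for powers -/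

section FiniteJumps

open Filter Topology

variable {X : Type*} {g : ℝ → X}

lemma eq_of_eventually_eq_on_Icc {a b : ℝ} (hab : a ≤ b)
    (hg : ∀ s ∈ Set.Icc a b, ∀ᶠ s' in 𝓝 s, g s' = g s) : g a = g b :=
  isPreconnected_Icc.induction₂ (fun s s' => g s = g s')
    (fun s hs => ((hg s hs).filter_mono nhdsWithin_le_nhds).mono fun _ h => h.symm)
    (fun _ _ _ _ _ _ h₁ h₂ => h₁.trans h₂) (fun _ _ _ _ h => h.symm)
    (Set.left_mem_Icc.2 hab) (Set.right_mem_Icc.2 hab)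

variable [PseudoMetricSpace X]

lemma eventually_dist_le_of_jump {b c J : ℝ} (hcb : c < b)
    (hg : ∀ s ∈ Set.Ioc c b, ∀ᶠ s' in 𝓝 s, g s' = g s)
    (hJ : ∀ᶠ q in 𝓝[≠] c ×ˢ 𝓝[≠] c, dist (g q.1) (g q.2) ≤ J) :
    ∀ᶠ x in 𝓝[<] c, dist (g x) (g b) ≤ J := by
  have hsides : 𝓝[<] c ×ˢ 𝓝[>] c ≤ 𝓝[≠] c ×ˢ 𝓝[≠] c :=
    prod_mono (nhdsLT_le_nhdsNE c) (nhdsGT_le_nhdsNE c)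
  filter_upwards [(hJ.filter_mono hsides).curry] with x hx
  obtain ⟨y, hxy, hy⟩ := (hx.and (Ioo_mem_nhdsGT hcb)).exists
  rwa [eq_of_eventually_eq_on_Icc hy.2.le fun s hs => hg s ⟨hy.1.trans_le hs.1, hs.2⟩] at hxy

lemma dist_le_sum_of_finite_jumps {ι : Type*} {t J : ι → ℝ} (F : Finset ι)
    {a b : ℝ} (hab : a ≤ b) (ht : Set.InjOn t F) (hF : ∀ i ∈ F, t i ∈ Set.Ioo a b)
    (hg : ∀ s ∈ Set.Icc a b, (∀ i ∈ F, t i ≠ s) → ∀ᶠ s' in 𝓝 s, g s' = g s)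
    (hJ : ∀ i ∈ F, ∀ᶠ q in 𝓝[≠] t i ×ˢ 𝓝[≠] t i, dist (g q.1) (g q.2) ≤ J i) :
    dist (g a) (g b) ≤ ∑ i ∈ F, J i := by
  classical
  induction F using Finset.induction_on_max_value t generalizing b with
  | empty => simp [eq_of_eventually_eq_on_Icc hab fun s hs => hg s hs (by simp)]
  | insert k F hk hmax ih =>
    obtain ⟨hka, hkb⟩ := hF k (F.mem_insert_self k)
    have hlt : ∀ i ∈ F, t i < t k := fun i hi => (hmax i hi).lt_of_ne fun h =>
      hk (ht (F.mem_insert_of_mem hi) (F.mem_insert_self k) h ▸ hi)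
    have hafter : ∀ s ∈ Set.Ioc (t k) b, ∀ᶠ s' in 𝓝 s, g s' = g s := fun s hs =>
      hg s ⟨(hka.trans hs.1).le, hs.2⟩ fun i hi =>
        (((Finset.forall_mem_insert k F (t · ≤ t k)).2 ⟨le_rfl, hmax⟩ i hi).trans_lt hs.1).ne
    have hbefore : ∀ᶠ x in 𝓝[<] t k, x ∈ Set.Ioo a (t k) := Ioo_mem_nhdsLT hka
    have hbeyond : ∀ᶠ x in 𝓝[<] t k, ∀ i ∈ F, t i < x :=
      (eventually_all_finset F).2 fun i hi =>
        mem_nhdsWithin_of_mem_nhds (Ioi_mem_nhds (hlt i hi))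
    obtain ⟨x, hxb, hx, hxF⟩ :=
      ((eventually_dist_le_of_jump hkb hafter (hJ k (F.mem_insert_self k))).and
        (hbefore.and hbeyond)).exists
    have hax : dist (g a) (g x) ≤ ∑ i ∈ F, J i := by
      refine ih hx.1.le (ht.mono (Finset.coe_subset.2 (F.subset_insert k)))
        (fun i hi => ⟨(hF i (F.mem_insert_of_mem hi)).1, hxF i hi⟩) (fun s hs hsF => ?_)
        fun i hi => hJ i (F.mem_insert_of_mem hi)
      have hsk : s < t k := hs.2.trans_lt hx.2
      exact hg s ⟨hs.1, (hsk.trans hkb).le⟩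
        ((Finset.forall_mem_insert _ _ _).2 ⟨hsk.ne', hsF⟩)
    rw [Finset.sum_insert hk, add_comm]
    exact (dist_triangle _ _ _).trans (add_le_add hax hxb)

end FiniteJumps

section PowerInequalities

lemma rpow_sub_rpow_le {p : ℝ} (hp : 1 ≤ p) {x y : ℝ} (hx : 0 ≤ x) (hy : 0 ≤ y) :
    x ^ p - y ^ p ≤ p * x ^ (p - 1) * (x - y) := by
  rcases hx.eq_or_lt with rfl | hx
  · rcases hp.eq_or_lt with rfl | hp
    · simp
    · simpa [Real.zero_rpow (by linarith : p ≠ 0), Real.zero_rpow (by linarith : p - 1 ≠ 0)]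
        using Real.rpow_nonneg hy p
  · have hbern : 1 + p * (y / x - 1) ≤ (y / x) ^ p := by
      simpa using one_add_mul_self_le_rpow_one_add
        (show -1 ≤ y / x - 1 by linarith [div_nonneg hy hx.le]) hp
    rw [Real.div_rpow hy hx.le, le_div_iff₀ (Real.rpow_pos_of_pos hx p)] at hbern
    have hxp : x ^ p = x ^ (p - 1) * x := by rw [← Real.rpow_add_one hx.ne', sub_add_cancel]
    have hexpand : (1 + p * (y / x - 1)) * x ^ p = x ^ p - p * x ^ (p - 1) * (x - y) := by
      rw [hxp]; field_simp; ring
    linarith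

lemma abs_abs_rpow_sub_abs_rpow_le {p : ℝ} (hp : 1 ≤ p) (x y : ℝ) :
    |(|x| ^ p - |y| ^ p)| ≤ p * (|x| ^ (p - 1) + |y| ^ (p - 1)) * |x - y| := by
  have hone (x y : ℝ) : |x| ^ p - |y| ^ p ≤ p * (|x| ^ (p - 1) + |y| ^ (p - 1)) * |x - y| :=
    calc |x| ^ p - |y| ^ p
        ≤ p * |x| ^ (p - 1) * (|x| - |y|) := rpow_sub_rpow_le hp (abs_nonneg x) (abs_nonneg y)
      _ ≤ p * |x| ^ (p - 1) * |x - y| := by gcongr; exact abs_sub_abs_le_abs_sub x y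
      _ ≤ p * (|x| ^ (p - 1) + |y| ^ (p - 1)) * |x - y| := by
        gcongr; exact le_add_of_nonneg_right (by positivity)
  rw [abs_sub_le_iff]
  exact ⟨hone x y, by simpa only [abs_sub_comm x y, add_comm] using hone y x⟩

lemma le_of_rpow_le_mul_rpow_sub_one {a b p : ℝ} (hp : p ≠ 0) (ha : 0 ≤ a)
    (hb : 0 ≤ b) (h : a ^ p ≤ b * a ^ (p - 1)) : a ≤ b := by
  rcases ha.eq_or_lt with rfl | ha
  · exact hb
  · refine le_of_mul_le_mul_right ?_ (Real.rpow_pos_of_pos ha (p - 1))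
    rwa [← Real.rpow_one_add' ha.le (by rwa [add_sub_cancel]), add_sub_cancel]

lemma sum_mul_rpow_sub_one_mul_le {ι : Type*} (s : Finset ι) {p : ℝ} (hp : 1 ≤ p)
    {m a b : ι → ℝ} (hm : ∀ i, 0 ≤ m i) (ha : ∀ i, 0 ≤ a i) (hb : ∀ i, 0 ≤ b i) :
    ∑ i ∈ s, m i * a i ^ (p - 1) * b i ≤
      (∑ i ∈ s, m i * a i ^ p) ^ (1 - p⁻¹) * (∑ i ∈ s, m i * b i ^ p) ^ p⁻¹ := by
  rcases hp.eq_or_lt with rfl | hp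
  · simp
  have hp0 : p ≠ 0 := by positivity
  have hp1 : p - 1 ≠ 0 := by linarith
  have hweight (i : ι) : m i * a i ^ (p - 1) * b i = m i * a i ^ p * (b i / a i) := by
    rcases (ha i).eq_or_lt with h0 | h0
    · simp [← h0, Real.zero_rpow hp0, Real.zero_rpow hp1]
    · rw [Real.rpow_sub_one h0.ne']; ring
  have hvalue (i : ι) : m i * a i ^ p * (b i / a i) ^ p ≤ m i * b i ^ p := by
    rcases (ha i).eq_or_lt with h0 | h0
    · rw [← h0, Real.zero_rpow hp0, mul_zero, zero_mul]
      exact mul_nonneg (hm i) (Real.rpow_nonneg (hb i) p)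
    · rw [Real.div_rpow (hb i) h0.le, mul_assoc,
        mul_div_cancel₀ _ (Real.rpow_pos_of_pos h0 p).ne']
  have hnonneg (i : ι) : 0 ≤ m i * a i ^ p * (b i / a i) ^ p :=
    mul_nonneg (mul_nonneg (hm i) (Real.rpow_nonneg (ha i) p))
      (Real.rpow_nonneg (div_nonneg (hb i) (ha i)) p)
  calc ∑ i ∈ s, m i * a i ^ (p - 1) * b i = ∑ i ∈ s, m i * a i ^ p * (b i / a i) := by
        simp only [hweight]
    _ ≤ (∑ i ∈ s, m i * a i ^ p) ^ (1 - p⁻¹) *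
          (∑ i ∈ s, m i * a i ^ p * (b i / a i) ^ p) ^ p⁻¹ :=
        Real.inner_le_weight_mul_Lp_of_nonneg s hp.le _ _
          (fun i => mul_nonneg (hm i) (Real.rpow_nonneg (ha i) p))
          fun i => div_nonneg (hb i) (ha i)
    _ ≤ _ := mul_le_mul_of_nonneg_left
        (Real.rpow_le_rpow (Finset.sum_nonneg fun i _ => hnonneg i)
          (Finset.sum_le_sum fun i _ => hvalue i) (by positivity))
        (Real.rpow_nonneg (Finset.sum_nonneg fun i _ =>
          mul_nonneg (hm i) (Real.rpow_nonneg (ha i) p)) _)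

end PowerInequalities

/-! ### Integrability gain from a translation bound -/

/-- The translates of `w` satisfy an `L¹` estimate of order one with constant `T`, as do the
translates of a function of total variation at most `T`. -/
def TranslationBound {E : Type*} [NormedAddCommGroup E] [MeasurableSpace E] (μ : Measure E)
    (w : E → ℝ) (T : ℝ) : Prop :=
  ∀ h, ∫⁻ x, ‖w (x + h) - w x‖ₑ ∂μ ≤ ENNReal.ofReal (T * ‖h‖)

section Translations

variable {E : Type*} [NormedAddCommGroup E] [MeasurableSpace E] {μ : Measure E} {w : E → ℝ}
  {R T t ρ : ℝ}

lemma TranslationBound.lintegral_enorm_le [NormedSpace ℝ E] [Nontrivial E]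
    (hT : TranslationBound μ w T) (hR : 0 ≤ R) (hsupp : Function.support w ⊆ Metric.ball 0 R) :
    ∫⁻ x, ‖w x‖ₑ ∂μ ≤ ENNReal.ofReal (T * (2 * R)) := by
  obtain ⟨h, hh⟩ := exists_norm_eq E (by positivity : 0 ≤ 2 * R)
  refine le_trans (lintegral_mono fun x => ?_) (hh ▸ hT h)
  by_cases hx : w x = 0
  · simp [hx]
  have hxR : ‖x‖ < R := by simpa using hsupp hx
  have hxh : w (x + h) = 0 := by
    refine Function.notMem_support.1 fun hmem => ?_
    have hxhR : ‖x + h‖ < R := by simpa using hsupp hmem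
    have := norm_sub_le (x + h) x
    rw [add_sub_cancel_left, hh] at this
    linarith
  rw [hxh, zero_sub, enorm_neg]

variable [BorelSpace E]

lemma mul_measure_le_setLIntegral_enorm_sub [μ.IsAddLeftInvariant] (hw : Measurable w)
    {Q : Set E} (hQtop : μ Q ≠ ⊤) (hQ : 2 * μ {x | t / 2 < |w x|} ≤ μ Q) {x : E}
    (hx : t < |w x|) :
    ENNReal.ofReal (t / 4) * μ Q ≤ ∫⁻ h in Q, ‖w (x + h) - w x‖ₑ ∂μ := by
  have hmeas : MeasurableSet {h | |w (x + h)| ≤ t / 2} :=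
    measurableSet_le (by fun_prop) measurable_const
  have hpre : μ {h | t / 2 < |w (x + h)|} = μ {y | t / 2 < |w y|} :=
    measure_preimage_add μ x {y | t / 2 < |w y|}
  have hcover : μ Q ≤ μ ({h | |w (x + h)| ≤ t / 2} ∩ Q) + μ {y | t / 2 < |w y|} := by
    rw [← hpre]
    refine (measure_mono fun h hh => ?_).trans (measure_union_le _ _)
    exact (le_or_gt |w (x + h)| (t / 2)).imp (fun h' => ⟨h', hh⟩) id
  have hhalf : μ Q / 2 ≤ μ ({h | |w (x + h)| ≤ t / 2} ∩ Q) := by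
    have hle : μ {y | t / 2 < |w y|} ≤ μ Q / 2 := by
      rw [ENNReal.le_div_iff_mul_le (by simp) (by simp), mul_comm]; exact hQ
    have hsum := hcover.trans (add_le_add_right hle _)
    nth_rw 1 [← ENNReal.add_halves (μ Q)] at hsum
    exact (ENNReal.add_le_add_iff_right (by finiteness)).1 hsum
  calc ENNReal.ofReal (t / 4) * μ Q = ENNReal.ofReal (t / 2) * (μ Q / 2) := by
        rw [show t / 4 = t / 2 / 2 by ring, ENNReal.ofReal_div_of_pos two_pos,
          ENNReal.ofReal_ofNat, ENNReal.div_eq_inv_mul, ENNReal.div_eq_inv_mul]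
        ring
    _ ≤ ENNReal.ofReal (t / 2) * μ.restrict Q {h | |w (x + h)| ≤ t / 2} := by
        rw [Measure.restrict_apply hmeas]; gcongr
    _ = ∫⁻ h in Q, {h | |w (x + h)| ≤ t / 2}.indicator (fun _ => ENNReal.ofReal (t / 2)) h ∂μ := by
        rw [lintegral_indicator_const hmeas]
    _ ≤ ∫⁻ h in Q, ‖w (x + h) - w x‖ₑ ∂μ := by
        refine lintegral_mono (Set.indicator_le fun h (hh : |w (x + h)| ≤ t / 2) => ?_)
        rw [← ofReal_norm, Real.norm_eq_abs, abs_sub_comm]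
        exact ENNReal.ofReal_le_ofReal (by linarith [abs_sub_abs_le_abs_sub (w x) (w (x + h))])

lemma TranslationBound.lintegral_lintegral_ball_le [SecondCountableTopology E] [SFinite μ]
    (hT : TranslationBound μ w T) (hw : Measurable w) (hT0 : 0 ≤ T) :
    ∫⁻ x, ∫⁻ h in Metric.ball 0 ρ, ‖w (x + h) - w x‖ₑ ∂μ ∂μ ≤
      ENNReal.ofReal (T * ρ) * μ (Metric.ball 0 ρ) := by
  calc ∫⁻ x, ∫⁻ h in Metric.ball 0 ρ, ‖w (x + h) - w x‖ₑ ∂μ ∂μ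
      = ∫⁻ h in Metric.ball 0 ρ, ∫⁻ x, ‖w (x + h) - w x‖ₑ ∂μ ∂μ :=
        lintegral_lintegral_swap (by fun_prop)
    _ ≤ ∫⁻ _ in Metric.ball 0 ρ, ENNReal.ofReal (T * ρ) ∂μ := by
        refine setLIntegral_mono measurable_const fun h hh => (hT h).trans ?_
        have : ‖h‖ < ρ := by simpa using hh
        gcongr
    _ = ENNReal.ofReal (T * ρ) * μ (Metric.ball 0 ρ) := setLIntegral_const _ _

variable [NormedSpace ℝ E] [FiniteDimensional ℝ E]

lemma TranslationBound.measure_lt_abs_le [μ.IsAddHaarMeasure]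
    (hT : TranslationBound μ w T) (hw : Measurable w) (hT0 : 0 ≤ T) (ht : 0 < t)
    (hρ : 2 * μ {x | t / 2 < |w x|} ≤ μ (Metric.ball 0 ρ)) :
    μ {x | t < |w x|} ≤ ENNReal.ofReal (4 * ρ * (T / t)) := by
  rcases eq_or_ne (μ (Metric.ball (0 : E) ρ)) 0 with hball | hball
  · have hhalf : μ {x | t / 2 < |w x|} = 0 := by simpa [hball] using hρ
    refine (measure_mono_null (fun x hx => ?_) hhalf).trans_le zero_le
    exact (half_lt_self ht).trans hx
  have htop : μ (Metric.ball (0 : E) ρ) ≠ ⊤ := measure_ball_lt_top.ne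
  have hmeas : MeasurableSet {x | t < |w x|} := measurableSet_lt measurable_const (by fun_prop)
  have hfubini : ENNReal.ofReal (t / 4) * μ (Metric.ball 0 ρ) * μ {x | t < |w x|} ≤
      ENNReal.ofReal (T * ρ) * μ (Metric.ball 0 ρ) := by
    refine le_trans ?_ (hT.lintegral_lintegral_ball_le hw hT0)
    rw [← lintegral_indicator_const hmeas]
    exact lintegral_mono (Set.indicator_le fun x hx =>
      mul_measure_le_setLIntegral_enorm_sub hw htop hρ hx)
  have hcancel : μ {x | t < |w x|} * ENNReal.ofReal (t / 4) ≤ ENNReal.ofReal (T * ρ) := by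
    rw [← ENNReal.mul_le_mul_iff_left hball htop]
    convert hfubini using 1
    ring
  rw [← ENNReal.le_div_iff_mul_le (by simp [ht]) (by simp),
    ← ENNReal.ofReal_div_of_pos (by positivity)] at hcancel
  convert hcancel using 2
  field_simp

lemma TranslationBound.exists_weakType_le [Nontrivial E] (μ : Measure E)
    [μ.IsAddHaarMeasure] (hR : 0 ≤ R) :
    ∃ A : ℝ, 0 ≤ A ∧ ∀ (w : E → ℝ) (T : ℝ), TranslationBound μ w T → Measurable w → 0 ≤ T →
      Function.support w ⊆ Metric.ball 0 R → ∀ t : ℝ, 0 < t →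
      μ {x | t < |w x|} ≤
        ENNReal.ofReal (A * (T / t) ^ (1 + (Module.finrank ℝ E : ℝ)⁻¹)) := by
  have hω : 0 < μ.real (Metric.ball (0 : E) 1) :=
    ENNReal.toReal_pos (Metric.measure_ball_pos _ _ one_pos).ne' measure_ball_lt_top.ne
  set ω := μ.real (Metric.ball (0 : E) 1) with hω_def
  set n := Module.finrank ℝ E
  have hn0 : n ≠ 0 := Module.finrank_pos.ne'
  refine ⟨4 * (8 * R / ω) ^ (n : ℝ)⁻¹, by positivity, fun w T hT hw hT0 hsupp t ht => ?_⟩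
  -- The radius of the ball of volume `8 R T / t`.
  set ρ : ℝ := (8 * R / ω * (T / t)) ^ (n : ℝ)⁻¹ with hρ
  have hball : μ (Metric.ball (0 : E) ρ) = ENNReal.ofReal (8 * R * (T / t)) := by
    rw [Measure.addHaar_ball _ _ (by positivity), ← ofReal_measureReal, ← hω_def,
      ← ENNReal.ofReal_mul (by positivity), hρ, Real.rpow_inv_natCast_pow (by positivity) hn0]
    congr 1
    field_simp
  have hmarkov : μ {x | t / 2 < |w x|} ≤ ENNReal.ofReal (4 * R * (T / t)) := by
    calc μ {x | t / 2 < |w x|} ≤ μ {x | ENNReal.ofReal (t / 2) ≤ ‖w x‖ₑ} :=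
          measure_mono fun x (hx : t / 2 < |w x|) => by
            rw [Set.mem_ofPred_eq, ← ofReal_norm]; exact ENNReal.ofReal_le_ofReal hx.le
      _ ≤ ENNReal.ofReal (T * (2 * R)) / ENNReal.ofReal (t / 2) :=
          (meas_ge_le_lintegral_div (by fun_prop) (by simpa using ht) (by simp)).trans
            (ENNReal.div_le_div_right (hT.lintegral_enorm_le hR hsupp) _)
      _ = ENNReal.ofReal (4 * R * (T / t)) := by
          rw [← ENNReal.ofReal_div_of_pos (by positivity)]
          congr 1; field_simp; ring
  calc μ {x | t < |w x|} ≤ ENNReal.ofReal (4 * ρ * (T / t)) := by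
        refine hT.measure_lt_abs_le hw hT0 ht ((mul_le_mul_right hmarkov 2).trans_eq ?_)
        rw [hball, ← ENNReal.ofReal_ofNat, ← ENNReal.ofReal_mul zero_le_two]
        congr 1; ring
    _ = _ := by
        have hTt : 0 ≤ T / t := by positivity
        rw [hρ, Real.mul_rpow (by positivity) hTt, Real.rpow_one_add' hTt (by positivity)]
        congr 1; ring

end Translations

section LayerCake

variable {α : Type*} [MeasurableSpace α] {μ : Measure α} {f : α → ℝ} {r s A T V : ℝ}

lemma lintegral_Ioc_ofReal_rpow (hr : 0 < r) (hT : 0 ≤ T) :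
    ∫⁻ t in Set.Ioc 0 T, ENNReal.ofReal (t ^ (r - 1)) = ENNReal.ofReal (T ^ r / r) := by
  have hint : IntegrableOn (fun t : ℝ => t ^ (r - 1)) (Set.Ioc 0 T) :=
    (intervalIntegrable_iff_integrableOn_Ioc_of_le hT).1
      (intervalIntegral.intervalIntegrable_rpow' (by linarith))
  rw [← ofReal_integral_eq_lintegral_ofReal hint
    ((ae_restrict_mem measurableSet_Ioc).mono fun t ht => Real.rpow_nonneg ht.1.le _),
    ← intervalIntegral.integral_of_le hT, integral_rpow (Or.inl (by linarith)), sub_add_cancel,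
    Real.zero_rpow hr.ne', sub_zero]

lemma lintegral_Ioi_ofReal_rpow (hrs : r < s) (hT : 0 < T) :
    ∫⁻ t in Set.Ioi T, ENNReal.ofReal ((T / t) ^ s * t ^ (r - 1)) =
      ENNReal.ofReal (T ^ r / (s - r)) := by
  have hexp : r - 1 - s < -1 := by linarith
  have hrw : ∀ t ∈ Set.Ioi T, ENNReal.ofReal ((T / t) ^ s * t ^ (r - 1)) =
      ENNReal.ofReal (T ^ s * t ^ (r - 1 - s)) := fun t ht => by
    have ht0 : 0 < t := hT.trans ht
    rw [Real.div_rpow hT.le ht0.le, Real.rpow_sub ht0 (r - 1)]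
    congr 1; ring
  rw [setLIntegral_congr_fun measurableSet_Ioi hrw, ← ofReal_integral_eq_lintegral_ofReal
    ((integrableOn_Ioi_rpow_of_lt hexp hT).const_mul _)
    ((ae_restrict_mem measurableSet_Ioi).mono fun t (ht : T < t) =>
      mul_nonneg (Real.rpow_nonneg hT.le _) (Real.rpow_nonneg (hT.trans ht).le _)),
    integral_const_mul, integral_Ioi_rpow_of_lt hexp hT, mul_div_assoc', mul_neg,
    ← Real.rpow_add hT, ← neg_div_neg_eq, neg_neg]
  congr 3 <;> ring

lemma lintegral_ofReal_rpow_le_of_weakType (hf : AEMeasurable f μ) (hf0 : 0 ≤ᵐ[μ] f) (hr : 0 < r)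
    (hrs : r < s) (hA : 0 ≤ A) (hT : 0 ≤ T) (hV : 0 ≤ V)
    (hbdd : ∀ t > 0, μ {x | t < f x} ≤ ENNReal.ofReal V)
    (hweak : ∀ t > 0, μ {x | t < f x} ≤ ENNReal.ofReal (A * (T / t) ^ s)) :
    ∫⁻ x, ENNReal.ofReal (f x ^ r) ∂μ ≤
      ENNReal.ofReal (r * (V / r + A / (s - r)) * T ^ r) := by
  have hlow : ∫⁻ t in Set.Ioc 0 T, μ {x | t < f x} * ENNReal.ofReal (t ^ (r - 1)) ≤
      ENNReal.ofReal (V * (T ^ r / r)) := by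
    rw [ENNReal.ofReal_mul hV, ← lintegral_Ioc_ofReal_rpow hr hT,
      ← lintegral_const_mul _ (by fun_prop)]
    exact setLIntegral_mono (by fun_prop) fun t ht => mul_le_mul_left (hbdd t ht.1) _
  have hhigh : ∫⁻ t in Set.Ioi T, μ {x | t < f x} * ENNReal.ofReal (t ^ (r - 1)) ≤
      ENNReal.ofReal (A * (T ^ r / (s - r))) := by
    have hle : ∀ t ∈ Set.Ioi T, μ {x | t < f x} * ENNReal.ofReal (t ^ (r - 1)) ≤
        ENNReal.ofReal A * ENNReal.ofReal ((T / t) ^ s * t ^ (r - 1)) := fun t ht => by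
      have ht0 : 0 < t := hT.trans_lt ht
      refine (mul_le_mul_left (hweak t ht0) _).trans_eq ?_
      rw [← ENNReal.ofReal_mul (by positivity), ← ENNReal.ofReal_mul hA, mul_assoc]
    refine (setLIntegral_mono (by fun_prop) hle).trans ?_
    rw [lintegral_const_mul _ (by fun_prop), ENNReal.ofReal_mul hA]
    rcases hT.eq_or_lt with rfl | hT
    · rw [setLIntegral_eq_zero measurableSet_Ioi fun t _ => by
        simp [Real.zero_rpow (hr.trans hrs).ne'], mul_zero]
      exact zero_le
    · rw [lintegral_Ioi_ofReal_rpow hrs hT]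
  rw [lintegral_rpow_eq_lintegral_meas_lt_mul μ hf0 hf hr, ← Set.Ioc_union_Ioi_eq_Ioi hT]
  calc _ ≤ ENNReal.ofReal r *
        (ENNReal.ofReal (V * (T ^ r / r)) + ENNReal.ofReal (A * (T ^ r / (s - r)))) := by
        gcongr
        exact (lintegral_union_le _ _ _).trans (add_le_add hlow hhigh)
    _ = _ := by
        have : 0 < s - r := sub_pos.2 hrs
        rw [← ENNReal.ofReal_add (by positivity) (by positivity), ← ENNReal.ofReal_mul hr.le]
        congr 1; ring

end LayerCake

lemma TranslationBound.exists_lintegral_rpow_le {E : Type*} [NormedAddCommGroup E]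
    [NormedSpace ℝ E] [FiniteDimensional ℝ E] [Nontrivial E] [MeasurableSpace E] [BorelSpace E]
    (μ : Measure E) [μ.IsAddHaarMeasure] {r R : ℝ} (hr : 0 < r)
    (hrs : r < 1 + (Module.finrank ℝ E : ℝ)⁻¹) (hR : 0 < R) :
    ∃ C : ℝ, 0 < C ∧ ∀ (w : E → ℝ) (T : ℝ), TranslationBound μ w T → Measurable w → 0 ≤ T →
      Function.support w ⊆ Metric.ball 0 R →
      ∫⁻ x, ENNReal.ofReal (|w x| ^ r) ∂μ ≤ ENNReal.ofReal (C * T ^ r) := by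
  obtain ⟨A, hA, hweak⟩ := TranslationBound.exists_weakType_le μ hR.le
  have : 0 < 1 + (Module.finrank ℝ E : ℝ)⁻¹ - r := sub_pos.2 hrs
  have hV : 0 < μ.real (Metric.ball 0 R) :=
    ENNReal.toReal_pos (Metric.measure_ball_pos μ 0 hR).ne' measure_ball_lt_top.ne
  refine ⟨r * (μ.real (Metric.ball 0 R) / r + A / (1 + (Module.finrank ℝ E : ℝ)⁻¹ - r)),
    by positivity, fun w T hT hw hT0 hsupp => ?_⟩
  refine lintegral_ofReal_rpow_le_of_weakType (by fun_prop)
    (Filter.Eventually.of_forall fun x => abs_nonneg (w x)) hr hrs hA hT0 measureReal_nonneg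
    (fun t ht => ?_) (hweak w T hT hw hT0 hsupp)
  rw [ofReal_measureReal measure_ball_lt_top.ne]
  exact measure_mono fun x hx => hsupp (abs_pos.1 (ht.trans hx))

/-! ### Discretisations -/

namespace SpaceDiscretisation

open Filter Topology

section Geometry

variable {d : ℕ} {Ω : Set (EuclideanSpace ℝ (Fin d))} (D : SpaceDiscretisation Ω)
  {K L σ τ : Set (EuclideanSpace ℝ (Fin d))} {x y z h : EuclideanSpace ℝ (Fin d)}

lemma mem_cellsOf : K ∈ D.cellsOf σ ↔ K ∈ D.cells ∧ σ ∈ D.edgesOf K := by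
  rw [cellsOf, Finset.mem_filter]

lemma mem_edges_of_mem_edgesOf (hK : K ∈ D.cells) (hσ : σ ∈ D.edgesOf K) : σ ∈ D.edges :=
  D.edgesOf_subset K hK hσ

lemma eq_of_mem_cell (hK : K ∈ D.cells) (hL : L ∈ D.cells) (hxK : x ∈ K) (hxL : x ∈ L) :
    K = L := by
  by_contra hKL
  exact Set.disjoint_left.1 (D.cells_disjoint K hK L hL hKL) hxK hxL

lemma eq_of_mem_edge (hσ : σ ∈ D.edges) (hτ : τ ∈ D.edges) (hxσ : x ∈ σ) (hxτ : x ∈ τ) :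
    σ = τ := by
  by_contra hστ
  exact Set.disjoint_left.1 (D.edges_disjoint σ hσ τ hτ hστ) hxσ hxτ

lemma isHyperplane_affineSpan_edge (hσ : σ ∈ D.edges) : IsHyperplane (affineSpan ℝ σ) :=
  ⟨(affineSpan_nonempty ℝ).2 (D.edge_nonempty σ hσ),
    by rw [D.edge_hyperplane σ hσ, finrank_euclideanSpace_fin]⟩

lemma closure_edge_subset_affineSpan (σ : Set (EuclideanSpace ℝ (Fin d))) :
    closure σ ⊆ affineSpan ℝ σ :=
  closure_minimal (subset_affineSpan ℝ σ) (AffineSubspace.closed_of_finiteDimensional _)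

lemma measurableSet_edge (hσ : σ ∈ D.edges) : MeasurableSet σ := by
  obtain ⟨U, hU, hσU⟩ := D.edge_isOpen σ hσ
  rw [hσU]
  exact hU.measurableSet.inter (AffineSubspace.closed_of_finiteDimensional _).measurableSet

lemma disjoint_closure_edge (hσ : σ ∈ D.edges) (hτ : τ ∈ D.edges) (hστ : σ ≠ τ)
    (hspan : affineSpan ℝ σ = affineSpan ℝ τ) : Disjoint σ (closure τ) := by
  obtain ⟨U, hU, hσU⟩ := D.edge_isOpen σ hσ
  have hUτ : Disjoint U τ := by
    rw [Set.disjoint_left]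
    intro x hxU hxτ
    refine hστ (D.eq_of_mem_edge hσ hτ ?_ hxτ)
    rw [hσU, hspan]
    exact ⟨hxU, subset_affineSpan ℝ τ hxτ⟩
  refine (hUτ.closure_right hU).mono_left ?_
  rw [hσU]
  exact Set.inter_subset_left

lemma closure_edge_subset_frontier (hK : K ∈ D.cells) (hσ : σ ∈ D.edgesOf K) :
    closure σ ⊆ closure K \ K := by
  rw [D.cell_boundary K hK]
  exact Set.subset_biUnion_of_mem (u := fun σ => closure σ) hσ

lemma exists_mem_closure_edge (hK : K ∈ D.cells) (hx : x ∈ closure K) (hxK : x ∉ K) :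
    ∃ σ ∈ D.edgesOf K, x ∈ closure σ := by
  have : x ∈ closure K \ K := ⟨hx, hxK⟩
  simpa only [D.cell_boundary K hK, Set.mem_iUnion, exists_prop] using this

lemma cellDist_pos (hK : K ∈ D.cells) (hσ : σ ∈ D.edgesOf K) : 0 < D.cellDist K σ :=
  D.center_dist_pos K hK σ hσ

lemma cellDist_nonneg : 0 ≤ D.cellDist K σ :=
  Metric.infDist_nonneg

lemma center_notMem_affineSpan_edge (hK : K ∈ D.cells) (hσ : σ ∈ D.edgesOf K) :
    D.center K ∉ affineSpan ℝ σ := fun h =>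
  (D.center_dist_pos K hK σ hσ).ne' (Metric.infDist_zero_of_mem h)

/-- The segment meets the boundary of the cell at most once in each of finitely many hyperplanes,
hence it enters the cell arbitrarily close to its endpoint `y`. -/
lemma lineMap_center_mem_cell (hK : K ∈ D.cells) (hy : y ∈ closure K) {r : ℝ}
    (hr : r ∈ Set.Ico (0 : ℝ) 1) : AffineMap.lineMap (D.center K) y r ∈ K := by
  have hstar {y} (hy : y ∈ K) {s : ℝ} (hs : s ∈ Set.Icc (0 : ℝ) 1) :
      AffineMap.lineMap (D.center K) y s ∈ K := by
    rw [AffineMap.lineMap_apply_module', add_comm]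
    exact (D.cell_starConvex K hK).add_smul_sub_mem hy hs.1 hs.2
  have hclosure {s : ℝ} (hs : s ∈ Set.Icc (0 : ℝ) 1) :
      AffineMap.lineMap (D.center K) y s ∈ closure K := by
    refine map_mem_closure (f := fun y => AffineMap.lineMap (D.center K) y s) ?_ hy
      fun y hy => hstar hy hs
    simp only [AffineMap.lineMap_apply_module']
    fun_prop
  have hfin : {s : ℝ | AffineMap.lineMap (D.center K) y s ∈ closure K \ K}.Finite := by
    refine ((D.edgesOf K).finite_toSet.biUnion fun σ hσ => Set.Subsingleton.finite
      (s := {s : ℝ | D.center K + s • (y - D.center K) ∈ affineSpan ℝ σ})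
      fun s hs t ht => ?_).subset fun s hs => ?_
    · exact (D.isHyperplane_affineSpan_edge (D.mem_edges_of_mem_edgesOf hK hσ)).eq_of_add_smul_mem
        (D.center_notMem_affineSpan_edge hK hσ) hs ht
    · obtain ⟨σ, hσ, hsσ⟩ := D.exists_mem_closure_edge hK hs.1 hs.2
      rw [AffineMap.lineMap_apply_module', add_comm] at hsσ
      exact Set.mem_biUnion hσ (closure_edge_subset_affineSpan σ hsσ)
  obtain ⟨s, hs, hsfin⟩ := (Set.Ioo_infinite hr.2).exists_notMem_finite hfin
  have hs0 : 0 < s := hr.1.trans_lt hs.1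
  have hsK : AffineMap.lineMap (D.center K) y s ∈ K :=
    not_not.1 fun hn => hsfin ⟨hclosure ⟨hs0.le, hs.2.le⟩, hn⟩
  have := hstar hsK ⟨div_nonneg hr.1 hs0.le, (div_le_one hs0).2 hs.1.le⟩
  rwa [AffineMap.lineMap_lineMap_right, div_mul_cancel₀ _ hs0.ne'] at this

lemma openCone_subset_cell (hK : K ∈ D.cells) (hσ : σ ∈ D.edgesOf K) :
    openCone (D.center K) σ ⊆ K := by
  rintro _ ⟨y, hy, r, hr, rfl⟩
  exact D.lineMap_center_mem_cell hK
    (D.closure_edge_subset_frontier hK hσ (subset_closure hy)).1 ⟨hr.1.le, hr.2⟩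

lemma eventually_mem_cell (hK : K ∈ D.cells) (hσ : σ ∈ D.edgesOf K) (hz : z ∈ σ) :
    ∀ᶠ y in 𝓝 z, (affineSpan ℝ σ).SSameSide (D.center K) y → y ∈ K := by
  have hσ' := D.mem_edges_of_mem_edgesOf hK hσ
  obtain ⟨U, hU, hσU⟩ := D.edge_isOpen σ hσ'
  have hzU : U ∈ 𝓝 z := hU.mem_nhds (hσU ▸ hz : z ∈ U ∩ affineSpan ℝ σ).1
  filter_upwards [(D.isHyperplane_affineSpan_edge hσ').eventually_mem_openCone
    (D.center_notMem_affineSpan_edge hK hσ) (subset_affineSpan ℝ σ hz) hzU] with y hy hside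
  exact D.openCone_subset_cell hK hσ (hσU ▸ hy hside)

lemma not_sSameSide_center (hK : K ∈ D.cells) (hL : L ∈ D.cells) (hKL : K ≠ L)
    (hσK : σ ∈ D.edgesOf K) (hσL : σ ∈ D.edgesOf L) :
    ¬ (affineSpan ℝ σ).SSameSide (D.center K) (D.center L) := by
  intro hside
  obtain ⟨z, hz⟩ := D.edge_nonempty σ (D.mem_edges_of_mem_edgesOf hK hσK)
  have hto : Tendsto (fun t : ℝ => AffineMap.lineMap z (D.center K) t) (𝓝[>] 0) (𝓝 z) := by
    have : Continuous fun t : ℝ => AffineMap.lineMap z (D.center K) t :=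
      AffineMap.lineMap_continuous
    simpa using (this.tendsto 0).mono_left nhdsWithin_le_nhds
  obtain ⟨t, ⟨htK, htL⟩, ht⟩ := ((hto.eventually ((D.eventually_mem_cell hK hσK hz).and
    (D.eventually_mem_cell hL hσL hz))).and self_mem_nhdsWithin).exists
  have hside' : (affineSpan ℝ σ).SSameSide (D.center K) (AffineMap.lineMap z (D.center K) t) :=
    AffineSubspace.sSameSide_lineMap_right (subset_affineSpan ℝ σ hz)
      (D.center_notMem_affineSpan_edge hK hσK) ht
  exact hKL (D.eq_of_mem_cell hK hL (htK hside') (htL (hside.symm.trans hside')))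

lemma card_cellsOf (hσ : σ ∈ D.edges) : (D.cellsOf σ).card = 1 ∨ (D.cellsOf σ).card = 2 := by
  have hcoe : {K | K ∈ D.cells ∧ σ ∈ D.edgesOf K} = (D.cellsOf σ : Set _) := by
    ext K
    exact D.mem_cellsOf.symm
  have := D.edge_cells σ hσ
  rw [hcoe, Set.ncard_coe_finset] at this
  exact this.imp_left And.left

lemma cellsOf_nonempty (hσ : σ ∈ D.edges) : (D.cellsOf σ).Nonempty := by
  rw [← Finset.card_pos]
  rcases D.card_cellsOf hσ with h | h <;> omega

lemma cellsOf_eq (hσ : σ ∈ D.edges) (hK : K ∈ D.cellsOf σ) :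
    D.cellsOf σ = {K} ∨ ∃ L, K ≠ L ∧ D.cellsOf σ = {K, L} := by
  rcases D.card_cellsOf hσ with h | h
  · obtain ⟨M, hM⟩ := Finset.card_eq_one.1 h
    rw [hM, Finset.mem_singleton] at hK
    exact Or.inl (hK ▸ hM)
  · obtain ⟨M, N, hMN, hcells⟩ := Finset.card_eq_two.1 h
    rw [hcells, Finset.mem_insert, Finset.mem_singleton] at hK
    rcases hK with rfl | rfl
    · exact Or.inr ⟨N, hMN, hcells⟩
    · exact Or.inr ⟨M, hMN.symm, by rw [hcells, Finset.pair_comm]⟩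

lemma sum_edges_cellsOf {M : Type*} [AddCommMonoid M]
    (F : Set (EuclideanSpace ℝ (Fin d)) → Set (EuclideanSpace ℝ (Fin d)) → M) :
    ∑ σ ∈ D.edges, ∑ K ∈ D.cellsOf σ, F K σ = ∑ K ∈ D.cells, ∑ σ ∈ D.edgesOf K, F K σ := by
  refine Finset.sum_comm' fun σ K => ?_
  rw [D.mem_cellsOf]
  exact ⟨fun ⟨_, hK, hσ⟩ => ⟨hσ, hK⟩,
    fun ⟨hσ, hK⟩ => ⟨D.mem_edges_of_mem_edgesOf hK hσ, hK, hσ⟩⟩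

lemma notMem_cell_of_mem_edge (hσ : σ ∈ D.edges) (hz : z ∈ σ) (hK : K ∈ D.cells) : z ∉ K := by
  intro hzK
  obtain ⟨L, hLσ⟩ := D.cellsOf_nonempty hσ
  obtain ⟨hL, hσL⟩ := D.mem_cellsOf.1 hLσ
  obtain ⟨hzL, hzL'⟩ := D.closure_edge_subset_frontier hL hσL (subset_closure hz)
  obtain ⟨y, hyK, hyL⟩ := mem_closure_iff.1 hzL K (D.cell_isOpen K hK) hzK
  exact hzL' (D.eq_of_mem_cell hK hL hyK hyL ▸ hzK)

lemma eventually_mem_cellsOf (hσ : σ ∈ D.edges) (hz : z ∈ σ)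
    (hzτ : ∀ τ ∈ D.edges, σ ≠ τ → z ∉ closure τ) :
    ∀ᶠ y in 𝓝 z, ∀ K ∈ D.cells, y ∈ K → K ∈ D.cellsOf σ := by
  rw [eventually_all_finset]
  intro K hK
  by_cases hσK : σ ∈ D.edgesOf K
  · exact Eventually.of_forall fun _ _ => D.mem_cellsOf.2 ⟨hK, hσK⟩
  have hzK : z ∉ closure K := by
    intro hzK
    obtain ⟨τ, hτ, hzτ'⟩ :=
      D.exists_mem_closure_edge hK hzK (D.notMem_cell_of_mem_edge hσ hz hK)
    refine hzτ τ (D.mem_edges_of_mem_edgesOf hK hτ) ?_ hzτ'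
    rintro rfl
    exact hσK hτ
  filter_upwards [isClosed_closure.isOpen_compl.mem_nhds hzK] with y hy hyK
  exact absurd (subset_closure hyK) hy

end Geometry

section PiecewiseConstant

variable {d : ℕ} {Ω : Set (EuclideanSpace ℝ (Fin d))} (D : SpaceDiscretisation Ω)
  {K L σ τ : Set (EuclideanSpace ℝ (Fin d))} {x z h : EuclideanSpace ℝ (Fin d)}
  (f : Set (EuclideanSpace ℝ (Fin d)) → ℝ)

/-- The piecewise constant function with cell values `f`, extended by zero outside the cells. -/
noncomputable def cellFun (x : EuclideanSpace ℝ (Fin d)) : ℝ :=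
  ∑ K ∈ D.cells, K.indicator (fun _ => f K) x

lemma measurable_cellFun : Measurable (D.cellFun f) :=
  Finset.measurable_fun_sum _ fun K hK =>
    measurable_const.indicator (D.cell_isOpen K hK).measurableSet

lemma cellFun_of_mem (hK : K ∈ D.cells) (hx : x ∈ K) : D.cellFun f x = f K := by
  rw [cellFun, Finset.sum_eq_single_of_mem K hK, Set.indicator_of_mem hx]
  exact fun L hL hLK =>
    Set.indicator_of_notMem (fun hxL => hLK (D.eq_of_mem_cell hL hK hxL hx)) _

lemma cellFun_of_forall_notMem (hx : ∀ K ∈ D.cells, x ∉ K) : D.cellFun f x = 0 :=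
  Finset.sum_eq_zero fun K hK => Set.indicator_of_notMem (hx K hK) _

lemma cellFun_comp {φ : ℝ → ℝ} (hφ : φ 0 = 0) :
    D.cellFun (fun K => φ (f K)) x = φ (D.cellFun f x) := by
  by_cases hx : ∃ K ∈ D.cells, x ∈ K
  · obtain ⟨K, hK, hxK⟩ := hx
    rw [D.cellFun_of_mem _ hK hxK, D.cellFun_of_mem _ hK hxK]
  · push Not at hx
    rw [D.cellFun_of_forall_notMem _ hx, D.cellFun_of_forall_notMem _ hx, hφ]

lemma eventually_cellFun_eq (hz : ∀ σ ∈ D.edges, z ∉ closure σ) :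
    ∀ᶠ y in 𝓝 z, D.cellFun f y = D.cellFun f z := by
  by_cases hcell : ∃ K ∈ D.cells, z ∈ K
  · obtain ⟨K, hK, hzK⟩ := hcell
    filter_upwards [(D.cell_isOpen K hK).mem_nhds hzK] with y hy
    rw [D.cellFun_of_mem f hK hy, D.cellFun_of_mem f hK hzK]
  · push Not at hcell
    have hev : ∀ᶠ y in 𝓝 z, ∀ K ∈ D.cells, y ∉ K := by
      rw [eventually_all_finset]
      intro K hK
      have hzK : z ∉ closure K := fun hzK => by
        obtain ⟨σ, hσ, hzσ⟩ := D.exists_mem_closure_edge hK hzK (hcell K hK)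
        exact hz σ (D.mem_edges_of_mem_edgesOf hK hσ) hzσ
      filter_upwards [isClosed_closure.isOpen_compl.mem_nhds hzK] with y hy hyK
      exact hy (subset_closure hyK)
    filter_upwards [hev] with y hy
    rw [D.cellFun_of_forall_notMem f hy, D.cellFun_of_forall_notMem f hcell]

lemma jump_nonneg : 0 ≤ D.jump f K σ := abs_nonneg _

lemma jump_of_cellsOf_eq_singleton (hσ : D.cellsOf σ = {K}) : D.jump f K σ = |f K| := by
  rw [jump, hσ, Finset.erase_singleton, Finset.sum_empty, sub_zero]

lemma jump_of_cellsOf_eq_pair (hKL : K ≠ L) (hσ : D.cellsOf σ = {K, L}) :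
    D.jump f K σ = |f K - f L| := by
  classical
  have : ∑ M ∈ (D.cellsOf σ).erase K, f M = f L := by
    rw [eq_comm, ← add_right_inj (f K), Finset.add_sum_erase _ _ (by simp [hσ]), hσ,
      Finset.sum_pair hKL]
  rw [← this, jump]

lemma eventually_cellFun_eq_or_eq_zero (hK : D.cellsOf σ = {K}) (hσ : σ ∈ D.edges) (hz : z ∈ σ)
    (hzτ : ∀ τ ∈ D.edges, σ ≠ τ → z ∉ closure τ) :
    ∀ᶠ y in 𝓝 z, D.cellFun f y = f K ∨ D.cellFun f y = 0 := by
  have hKσ := D.mem_cellsOf.1 (hK ▸ Finset.mem_singleton_self K)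
  filter_upwards [D.eventually_mem_cellsOf hσ hz hzτ] with y hy
  by_cases hyK : y ∈ K
  · exact Or.inl (D.cellFun_of_mem f hKσ.1 hyK)
  · refine Or.inr (D.cellFun_of_forall_notMem f fun L hL hyL => hyK ?_)
    have := hy L hL hyL
    rw [hK, Finset.mem_singleton] at this
    exact this ▸ hyL

lemma eventually_cellFun_eq_or_eq (hKL : K ≠ L) (hK : K ∈ D.cellsOf σ) (hL : L ∈ D.cellsOf σ)
    (hz : z ∈ σ) :
    ∀ᶠ y in 𝓝 z, y ∉ affineSpan ℝ σ → D.cellFun f y = f K ∨ D.cellFun f y = f L := by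
  obtain ⟨hK, hσK⟩ := D.mem_cellsOf.1 hK
  obtain ⟨hL, hσL⟩ := D.mem_cellsOf.1 hL
  filter_upwards [D.eventually_mem_cell hK hσK hz, D.eventually_mem_cell hL hσL hz]
    with y hyK hyL hy
  have hH := D.isHyperplane_affineSpan_edge (D.mem_edges_of_mem_edgesOf hK hσK)
  exact (hH.sSameSide_or_sSameSide
    (D.center_notMem_affineSpan_edge hK hσK) (D.center_notMem_affineSpan_edge hL hσL) hy
    (D.not_sSameSide_center hK hL hKL hσK hσL)).imp
    (fun hside => D.cellFun_of_mem f hK (hyK hside))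
    (fun hside => D.cellFun_of_mem f hL (hyL hside))

lemma eventually_dist_cellFun_le (hσ : σ ∈ D.edges) (hz : z ∈ σ)
    (hzτ : ∀ τ ∈ D.edges, σ ≠ τ → z ∉ closure τ) :
    ∀ᶠ q in 𝓝[(affineSpan ℝ σ : Set _)ᶜ] z ×ˢ 𝓝[(affineSpan ℝ σ : Set _)ᶜ] z,
      dist (D.cellFun f q.1) (D.cellFun f q.2) ≤ ∑ K ∈ D.cellsOf σ, D.jump f K σ := by
  obtain ⟨K, hK⟩ := D.cellsOf_nonempty hσ
  have hjump : D.jump f K σ ≤ ∑ K ∈ D.cellsOf σ, D.jump f K σ :=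
    Finset.single_le_sum (f := fun K => D.jump f K σ) (fun K _ => D.jump_nonneg f) hK
  have hosc {a : ℝ} (ha : D.jump f K σ = dist (f K) a)
      (hev : ∀ᶠ y in 𝓝[(affineSpan ℝ σ : Set _)ᶜ] z, D.cellFun f y = f K ∨ D.cellFun f y = a) :
      ∀ᶠ q in 𝓝[(affineSpan ℝ σ : Set _)ᶜ] z ×ˢ 𝓝[(affineSpan ℝ σ : Set _)ᶜ] z,
        dist (D.cellFun f q.1) (D.cellFun f q.2) ≤ ∑ K ∈ D.cellsOf σ, D.jump f K σ := by
    filter_upwards [hev.prod_mk hev] with q ⟨h₁, h₂⟩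
    refine le_trans ?_ (ha ▸ hjump)
    rcases h₁ with h₁ | h₁ <;> rcases h₂ with h₂ | h₂ <;> simp [h₁, h₂, dist_comm a]
  rcases D.cellsOf_eq hσ hK with hcells | ⟨L, hKL, hcells⟩
  · refine hosc (a := 0) ?_
      ((D.eventually_cellFun_eq_or_eq_zero f hcells hσ hz hzτ).filter_mono nhdsWithin_le_nhds)
    rw [D.jump_of_cellsOf_eq_singleton f hcells, dist_zero_right, Real.norm_eq_abs]
  · refine hosc (D.jump_of_cellsOf_eq_pair f hKL hcells) (eventually_nhdsWithin_iff.2 ?_)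
    exact D.eventually_cellFun_eq_or_eq f hKL hK (by simp [hcells]) hz

/-- The segment from `x` to `x + h` is in general position with respect to the edges: its endpoints
avoid the hyperplanes of the edges, and the line through it meets neither the relative boundary of
an edge nor two edges at the same point. -/
structure InGeneralPosition (x h : EuclideanSpace ℝ (Fin d)) : Prop where
  left_notMem : ∀ σ ∈ D.edges, x ∉ affineSpan ℝ σ
  right_notMem : ∀ σ ∈ D.edges, x + h ∉ affineSpan ℝ σ
  mem_of_mem_closure : ∀ σ ∈ D.edges, ∀ s : ℝ, x + s • h ∈ closure σ → x + s • h ∈ σ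
  notMem_closure_of_ne : ∀ σ ∈ D.edges, ∀ τ ∈ D.edges, σ ≠ τ → ∀ s : ℝ,
    x + s • h ∈ σ → x + s • h ∉ closure τ

lemma ae_notMem_affineSpan_edge (h : EuclideanSpace ℝ (Fin d)) :
    ∀ᵐ x, ∀ σ ∈ D.edges, x + h ∉ affineSpan ℝ σ := by
  rw [eventually_all_finset]
  intro σ hσ
  exact (measurePreserving_add_right volume h).quasiMeasurePreserving.ae
    (measure_eq_zero_iff_ae_notMem.1 (D.isHyperplane_affineSpan_edge hσ).volume_eq_zero)

lemma ae_mem_edge_of_mem_closure (hσ : σ ∈ D.edges) (h : EuclideanSpace ℝ (Fin d)) :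
    ∀ᵐ x : EuclideanSpace ℝ (Fin d), ∀ s : ℝ, x + s • h ∈ closure σ → x + s • h ∈ σ := by
  have hnull : volume {x : EuclideanSpace ℝ (Fin d) | ∃ s ∈ (Set.univ : Set ℝ),
      x + s • h ∈ closure σ \ σ} = 0 := by
    have hle := (D.isHyperplane_affineSpan_edge hσ).volume_setOf_exists_add_smul_mem_le
      (isClosed_closure.measurableSet.diff (D.measurableSet_edge hσ))
      (Set.sdiff_subset.trans (closure_edge_subset_affineSpan σ)) MeasurableSet.univ h
    rwa [finrank_euclideanSpace_fin, D.edge_boundary_null σ hσ, mul_zero, nonpos_iff_eq_zero] at hle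
  filter_upwards [measure_eq_zero_iff_ae_notMem.1 hnull] with x hx s hs
  by_contra hsσ
  exact hx ⟨s, trivial, hs, hsσ⟩

lemma ae_notMem_closure_edge_of_ne (hσ : σ ∈ D.edges) (hτ : τ ∈ D.edges) (hστ : σ ≠ τ)
    (h : EuclideanSpace ℝ (Fin d)) :
    ∀ᵐ x, ∀ s : ℝ, x + s • h ∈ σ → x + s • h ∉ closure τ := by
  by_cases hspan : affineSpan ℝ σ = affineSpan ℝ τ
  · exact Eventually.of_forall fun x s hs =>
      Set.disjoint_left.1 (D.disjoint_closure_edge hσ hτ hστ hspan) hs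
  · filter_upwards [measure_eq_zero_iff_ae_notMem.1
      ((D.isHyperplane_affineSpan_edge hσ).volume_setOf_exists_add_smul_mem_inf_eq_zero
        (D.isHyperplane_affineSpan_edge hτ) hspan h)] with x hx s hsσ hsτ
    exact hx ⟨s, subset_affineSpan ℝ σ hsσ, closure_edge_subset_affineSpan τ hsτ⟩

lemma ae_inGeneralPosition (h : EuclideanSpace ℝ (Fin d)) : ∀ᵐ x, D.InGeneralPosition x h := by
  have hclosure : ∀ᵐ x, ∀ σ ∈ D.edges, ∀ s : ℝ, x + s • h ∈ closure σ → x + s • h ∈ σ := by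
    rw [eventually_all_finset]
    exact fun σ hσ => D.ae_mem_edge_of_mem_closure hσ h
  have hne : ∀ᵐ x, ∀ σ ∈ D.edges, ∀ τ ∈ D.edges, σ ≠ τ → ∀ s : ℝ,
      x + s • h ∈ σ → x + s • h ∉ closure τ := by
    simp only [eventually_all_finset, eventually_imp_distrib_left]
    exact fun σ hσ τ hτ hστ => D.ae_notMem_closure_edge_of_ne hσ hτ hστ h
  filter_upwards [D.ae_notMem_affineSpan_edge 0, D.ae_notMem_affineSpan_edge h, hclosure, hne]
    with x hx₀ hx₁ hx₂ hx₃
  exact ⟨by simpa only [add_zero] using hx₀, hx₁, hx₂, hx₃⟩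

namespace InGeneralPosition

variable {D}

lemma eq_of_add_smul_mem (hx : D.InGeneralPosition x h) (hσ : σ ∈ D.edges) {s t : ℝ}
    (hs : x + s • h ∈ σ) (ht : x + t • h ∈ affineSpan ℝ σ) : s = t :=
  (D.isHyperplane_affineSpan_edge hσ).eq_of_add_smul_mem (hx.left_notMem σ hσ)
    (subset_affineSpan ℝ σ hs) ht

lemma mem_Ioo_of_mem_Icc (hx : D.InGeneralPosition x h) (hσ : σ ∈ D.edges) {s : ℝ}
    (hs : x + s • h ∈ σ) (hs01 : s ∈ Set.Icc (0 : ℝ) 1) : s ∈ Set.Ioo (0 : ℝ) 1 := by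
  have hmem : x + s • h ∈ affineSpan ℝ σ := subset_affineSpan ℝ σ hs
  refine ⟨hs01.1.lt_of_ne' fun h₀ => hx.left_notMem σ hσ ?_,
    hs01.2.lt_of_ne fun h₁ => hx.right_notMem σ hσ ?_⟩
  · simpa only [h₀, zero_smul, add_zero] using hmem
  · simpa only [h₁, one_smul] using hmem

lemma eventually_dist_cellFun_le (hx : D.InGeneralPosition x h) (hσ : σ ∈ D.edges) {t : ℝ}
    (ht : x + t • h ∈ σ) :
    ∀ᶠ q in 𝓝[≠] t ×ˢ 𝓝[≠] t,
      dist (D.cellFun f (x + q.1 • h)) (D.cellFun f (x + q.2 • h)) ≤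
        ∑ K ∈ D.cellsOf σ, D.jump f K σ := by
  have hcont : Continuous fun s : ℝ => x + s • h := by fun_prop
  have hto : Tendsto (fun s : ℝ => x + s • h) (𝓝[≠] t)
      (𝓝[(affineSpan ℝ σ : Set _)ᶜ] (x + t • h)) :=
    tendsto_nhdsWithin_iff.2 ⟨hcont.continuousAt.mono_left nhdsWithin_le_nhds,
      eventually_nhdsWithin_of_forall fun s hs hmem => hs (hx.eq_of_add_smul_mem hσ ht hmem).symm⟩
  exact (hto.prodMap hto).eventually (D.eventually_dist_cellFun_le f hσ ht
    fun τ hτ hστ => hx.notMem_closure_of_ne σ hσ τ hτ hστ t ht)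

lemma dist_cellFun_le (hx : D.InGeneralPosition x h) :
    dist (D.cellFun f x) (D.cellFun f (x + h)) ≤ ∑ σ ∈ D.edges,
      {x | ∃ s ∈ Set.Icc (0 : ℝ) 1, x + s • h ∈ σ}.indicator
        (fun _ => ∑ K ∈ D.cellsOf σ, D.jump f K σ) x := by
  classical
  let F := D.edges.filter fun σ => ∃ s ∈ Set.Icc (0 : ℝ) 1, x + s • h ∈ σ
  have hF {σ} (hσ : σ ∈ F) : σ ∈ D.edges := (Finset.mem_filter.1 hσ).1
  choose! t htI htσ using fun σ (hσ : σ ∈ F) => (Finset.mem_filter.1 hσ).2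
  have hcont : Continuous fun s : ℝ => x + s • h := by fun_prop
  have hvar : dist (D.cellFun f (x + (0 : ℝ) • h)) (D.cellFun f (x + (1 : ℝ) • h)) ≤
      ∑ σ ∈ F, ∑ K ∈ D.cellsOf σ, D.jump f K σ := by
    refine dist_le_sum_of_finite_jumps (g := fun s : ℝ => D.cellFun f (x + s • h)) (t := t) F
      zero_le_one (fun σ hσ τ hτ hst => ?_)
      (fun σ hσ => hx.mem_Ioo_of_mem_Icc (hF hσ) (htσ σ hσ) (htI σ hσ)) (fun s hs hsF => ?_)
      fun σ hσ => hx.eventually_dist_cellFun_le f (hF hσ) (htσ σ hσ)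
    · by_contra hστ
      exact hx.notMem_closure_of_ne σ (hF hσ) τ (hF hτ) hστ (t σ) (htσ σ hσ)
        (subset_closure (hst ▸ htσ τ hτ))
    · refine hcont.continuousAt.eventually (D.eventually_cellFun_eq f fun σ hσ hsσ => ?_)
      have hmem := hx.mem_of_mem_closure σ hσ s hsσ
      have hσF : σ ∈ F := Finset.mem_filter.2 ⟨hσ, s, hs, hmem⟩
      exact hsF σ hσF (hx.eq_of_add_smul_mem hσ (htσ σ hσF) (subset_affineSpan ℝ σ hmem))
  simp only [zero_smul, add_zero, one_smul] at hvar
  simpa only [Set.indicator_apply, Set.mem_ofPred_eq, F, Finset.sum_filter] using hvar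

end InGeneralPosition

end PiecewiseConstant

section TotalVariation

variable {d : ℕ} {Ω : Set (EuclideanSpace ℝ (Fin d))} (D : SpaceDiscretisation Ω)
  {K σ τ : Set (EuclideanSpace ℝ (Fin d))} {y z : EuclideanSpace ℝ (Fin d)}

lemma eq_of_lineMap_center_eq (hK : K ∈ D.cells) (hy : y ∈ closure K \ K)
    (hz : z ∈ closure K \ K) {r s : ℝ} (hr : 0 < r) (hs : 0 < s)
    (h : AffineMap.lineMap (D.center K) y r = AffineMap.lineMap (D.center K) z s) : y = z := by
  wlog hsr : s ≤ r generalizing y z r s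
  · exact (this hz hy hs hr h.symm (not_le.1 hsr).le).symm
  have hyz : y = AffineMap.lineMap (D.center K) z (s / r) := by
    rw [← AffineMap.lineMap_apply_one (k := ℝ) (D.center K) y, ← inv_mul_cancel₀ hr.ne',
      ← AffineMap.lineMap_lineMap_right, h, AffineMap.lineMap_lineMap_right, div_eq_inv_mul]
  rcases hsr.lt_or_eq with hsr | rfl
  · exact absurd (hyz ▸ D.lineMap_center_mem_cell hK hz.1 ⟨by positivity, (div_lt_one hr).2 hsr⟩)
      hy.2
  · rwa [div_self hs.ne', AffineMap.lineMap_apply_one] at hyz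

lemma disjoint_openCone (hK : K ∈ D.cells) (hσ : σ ∈ D.edgesOf K) (hτ : τ ∈ D.edgesOf K)
    (hστ : σ ≠ τ) : Disjoint (openCone (D.center K) σ) (openCone (D.center K) τ) := by
  rw [Set.disjoint_left]
  rintro _ ⟨y, hy, r, hr, rfl⟩ ⟨z, hz, s, hs, hzy⟩
  have hyz := D.eq_of_lineMap_center_eq hK
    (D.closure_edge_subset_frontier hK hτ (subset_closure hz))
    (D.closure_edge_subset_frontier hK hσ (subset_closure hy)) hs.1 hr.1 hzy
  exact hστ (D.eq_of_mem_edge (D.mem_edges_of_mem_edgesOf hK hσ)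
    (D.mem_edges_of_mem_edgesOf hK hτ) hy (hyz ▸ hz))

lemma sum_cellDist_mul_le (hK : K ∈ D.cells) :
    ∑ σ ∈ D.edgesOf K, ENNReal.ofReal (D.cellDist K σ) * μHE[d - 1] σ ≤ d * volume K := by
  have hedge {σ} (hσ : σ ∈ D.edgesOf K) := D.mem_edges_of_mem_edgesOf hK hσ
  calc ∑ σ ∈ D.edgesOf K, ENNReal.ofReal (D.cellDist K σ) * μHE[d - 1] σ
      = ∑ σ ∈ D.edgesOf K, d * volume (openCone (D.center K) σ) :=
        Finset.sum_congr rfl fun σ hσ => by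
          have := (D.isHyperplane_affineSpan_edge (hedge hσ)).finrank_mul_volume_openCone
            (D.center_notMem_affineSpan_edge hK hσ) (D.measurableSet_edge (hedge hσ))
            (subset_affineSpan ℝ σ)
          rwa [finrank_euclideanSpace_fin, eq_comm] at this
    _ = d * volume (⋃ σ ∈ D.edgesOf K, openCone (D.center K) σ) := by
        rw [← Finset.mul_sum, measure_biUnion_finset
          (fun σ hσ τ hτ hστ => D.disjoint_openCone hK hσ hτ hστ) fun σ hσ =>
            (D.isHyperplane_affineSpan_edge (hedge hσ)).measurableSet_openCone
              (D.center_notMem_affineSpan_edge hK hσ) (D.measurableSet_edge (hedge hσ))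
              (subset_affineSpan ℝ σ)]
    _ ≤ d * volume K := by
        gcongr
        exact Set.iUnion₂_subset fun σ hσ => D.openCone_subset_cell hK hσ

lemma volume_cell_ne_top (hΩ : Bornology.IsBounded Ω) (hK : K ∈ D.cells) : volume K ≠ ⊤ :=
  (hΩ.subset (D.cell_subset K hK)).measure_lt_top.ne

lemma edge_measure_ne_top (hΩ : Bornology.IsBounded Ω) (hσ : σ ∈ D.edges) :
    μHE[d - 1] σ ≠ ⊤ := by
  obtain ⟨K, hK⟩ := D.cellsOf_nonempty hσ
  obtain ⟨hK, hσK⟩ := D.mem_cellsOf.1 hK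
  have hle : ENNReal.ofReal (D.cellDist K σ) * μHE[d - 1] σ ≤ d * volume K :=
    (Finset.single_le_sum (f := fun σ => ENNReal.ofReal (D.cellDist K σ) * μHE[d - 1] σ)
      (fun _ _ => zero_le) hσK).trans (D.sum_cellDist_mul_le hK)
  have hfin := ne_top_of_le_ne_top
    (ENNReal.mul_ne_top (ENNReal.natCast_ne_top d) (D.volume_cell_ne_top hΩ hK)) hle
  exact (ENNReal.lt_top_of_mul_ne_top_right hfin
    (ENNReal.ofReal_pos.2 (D.cellDist_pos hK hσK)).ne').ne

lemma sum_measure_mul_cellDist_le (hΩ : Bornology.IsBounded Ω) (hK : K ∈ D.cells) :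
    ∑ σ ∈ D.edgesOf K, (μHE[d - 1] σ).toReal * D.cellDist K σ ≤ d * (volume K).toReal := by
  have hle := ENNReal.toReal_mono
    (ENNReal.mul_ne_top (ENNReal.natCast_ne_top d) (D.volume_cell_ne_top hΩ hK))
    (D.sum_cellDist_mul_le hK)
  rw [ENNReal.toReal_sum fun σ hσ => ENNReal.mul_ne_top ENNReal.ofReal_ne_top
    (D.edge_measure_ne_top hΩ (D.mem_edges_of_mem_edgesOf hK hσ))] at hle
  simpa only [ENNReal.toReal_mul, ENNReal.toReal_ofReal D.cellDist_nonneg,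
    mul_comm (D.cellDist _ _), ENNReal.toReal_natCast] using hle

/-- The total variation of the piecewise constant function with cell values `f`; each interior
interface is counted once from either side. -/
noncomputable def totalVariation (f : Set (EuclideanSpace ℝ (Fin d)) → ℝ) : ℝ :=
  ∑ K ∈ D.cells, ∑ σ ∈ D.edgesOf K, (μHE[d - 1] σ).toReal * D.jump f K σ

variable (f : Set (EuclideanSpace ℝ (Fin d)) → ℝ)

lemma totalVariation_eq_sum_edges : D.totalVariation f =
    ∑ σ ∈ D.edges, (μHE[d - 1] σ).toReal * ∑ K ∈ D.cellsOf σ, D.jump f K σ := by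
  simp only [Finset.mul_sum]
  exact (D.sum_edges_cellsOf fun K σ => (μHE[d - 1] σ).toReal * D.jump f K σ).symm

lemma totalVariation_nonneg : 0 ≤ D.totalVariation f :=
  Finset.sum_nonneg fun _ _ => Finset.sum_nonneg fun _ _ =>
    mul_nonneg ENNReal.toReal_nonneg (D.jump_nonneg f)

lemma ofReal_mul_volume_setOf_exists_add_smul_mem_le (hΩ : Bornology.IsBounded Ω)
    (hσ : σ ∈ D.edges) {J : ℝ} (hJ : 0 ≤ J) (h : EuclideanSpace ℝ (Fin d)) :
    ENNReal.ofReal J * volume {x | ∃ s ∈ Set.Icc (0 : ℝ) 1, x + s • h ∈ σ} ≤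
      ENNReal.ofReal ((μHE[d - 1] σ).toReal * J * ‖h‖) := by
  have hle := (D.isHyperplane_affineSpan_edge hσ).volume_setOf_exists_add_smul_mem_le
    (D.measurableSet_edge hσ) (subset_affineSpan ℝ σ) (measurableSet_Icc (a := 0) (b := 1)) h
  rw [Real.volume_Icc, sub_zero, ENNReal.ofReal_one, one_mul, finrank_euclideanSpace_fin,
    ← ENNReal.ofReal_toReal (D.edge_measure_ne_top hΩ hσ),
    ← ENNReal.ofReal_mul (norm_nonneg _)] at hle
  calc ENNReal.ofReal J * volume {x | ∃ s ∈ Set.Icc (0 : ℝ) 1, x + s • h ∈ σ}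
      ≤ ENNReal.ofReal J * ENNReal.ofReal (‖h‖ * (μHE[d - 1] σ).toReal) := by gcongr
    _ = ENNReal.ofReal ((μHE[d - 1] σ).toReal * J * ‖h‖) := by
        rw [← ENNReal.ofReal_mul hJ]
        ring_nf

lemma translationBound_cellFun (hΩ : Bornology.IsBounded Ω) :
    TranslationBound volume (D.cellFun f) (D.totalVariation f) := by
  intro h
  let J (σ : Set (EuclideanSpace ℝ (Fin d))) : ℝ := ∑ K ∈ D.cellsOf σ, D.jump f K σ
  have hJ (σ) : 0 ≤ J σ := Finset.sum_nonneg fun K _ => D.jump_nonneg f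
  let A (σ : Set (EuclideanSpace ℝ (Fin d))) : Set (EuclideanSpace ℝ (Fin d)) :=
    {x | ∃ s ∈ Set.Icc (0 : ℝ) 1, x + s • h ∈ σ}
  have hmeas (σ) : MeasurableSet (toMeasurable volume (A σ)) := measurableSet_toMeasurable _ _
  calc ∫⁻ x, ‖D.cellFun f (x + h) - D.cellFun f x‖ₑ
      ≤ ∫⁻ x, ∑ σ ∈ D.edges,
          (toMeasurable volume (A σ)).indicator (fun _ => ENNReal.ofReal (J σ)) x := by
        refine lintegral_mono_ae ?_
        filter_upwards [D.ae_inGeneralPosition h] with x hx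
        rw [← edist_eq_enorm_sub, edist_comm, edist_dist]
        refine (ENNReal.ofReal_le_ofReal (hx.dist_cellFun_le f)).trans ?_
        rw [ENNReal.ofReal_sum_of_nonneg fun σ _ => Set.indicator_nonneg (fun _ _ => hJ σ) x]
        refine Finset.sum_le_sum fun σ _ => ?_
        rw [← Function.comp_apply (f := ENNReal.ofReal),
          ← Set.indicator_comp_of_zero ENNReal.ofReal_zero]
        exact Set.indicator_le_indicator_of_subset (subset_toMeasurable _ _) (fun _ => zero_le) x
    _ = ∑ σ ∈ D.edges, ENNReal.ofReal (J σ) * volume (A σ) := by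
        rw [lintegral_finsetSum _ fun σ _ => measurable_const.indicator (hmeas σ)]
        simp only [lintegral_indicator_const (hmeas _), measure_toMeasurable]
    _ ≤ ∑ σ ∈ D.edges, ENNReal.ofReal ((μHE[d - 1] σ).toReal * J σ * ‖h‖) :=
        Finset.sum_le_sum fun σ hσ =>
          D.ofReal_mul_volume_setOf_exists_add_smul_mem_le hΩ hσ (hJ σ) h
    _ = ENNReal.ofReal (D.totalVariation f * ‖h‖) := by
        rw [totalVariation_eq_sum_edges, Finset.sum_mul, ENNReal.ofReal_sum_of_nonneg]
        exact fun σ _ => mul_nonneg (mul_nonneg ENNReal.toReal_nonneg (hJ σ)) (norm_nonneg h)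

end TotalVariation

section DiscreteNorms

variable {d : ℕ} {Ω : Set (EuclideanSpace ℝ (Fin d))} (D : SpaceDiscretisation Ω)
  {K σ : Set (EuclideanSpace ℝ (Fin d))} {p q η R : ℝ}

lemma edgeDist_pos (hσ : σ ∈ D.edges) : 0 < D.edgeDist σ :=
  Finset.sum_pos (fun _ hK => D.cellDist_pos (D.mem_cellsOf.1 hK).1 (D.mem_cellsOf.1 hK).2)
    (D.cellsOf_nonempty hσ)

lemma edgeDist_nonneg : 0 ≤ D.edgeDist σ :=
  Finset.sum_nonneg fun _ _ => D.cellDist_nonneg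

lemma edgeDist_le (hη : 0 < η) (hD : D.RatioBound η) (hσ : σ ∈ D.edges) (hK : K ∈ D.cellsOf σ) :
    D.edgeDist σ ≤ (1 + 1 / η) * D.cellDist K σ := by
  have hpos := D.cellDist_pos (D.mem_cellsOf.1 hK).1 (D.mem_cellsOf.1 hK).2
  rw [one_add_mul]
  rcases D.cellsOf_eq hσ hK with hcells | ⟨L, hKL, hcells⟩
  · rw [edgeDist, hcells, Finset.sum_singleton]
    exact le_add_of_nonneg_right (by positivity)
  · rw [edgeDist, hcells, Finset.sum_pair hKL]
    have hL : L ∈ D.cellsOf σ := by simp [hcells]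
    exact add_le_add_right ((div_le_iff₀ hpos).1 (hD σ hσ L hL K hK hKL.symm).2) _

variable (v : Set (EuclideanSpace ℝ (Fin d)) → ℝ)

/-- The `L^p` norm of the piecewise constant function with cell values `v`. -/
noncomputable def discreteLpNorm (p : ℝ) (v : Set (EuclideanSpace ℝ (Fin d)) → ℝ) : ℝ :=
  (∑ K ∈ D.cells, (volume K).toReal * |v K| ^ p) ^ (1 / p)

lemma sum_volume_mul_abs_rpow_nonneg : 0 ≤ ∑ K ∈ D.cells, (volume K).toReal * |v K| ^ p := by
  positivity

lemma discreteLpNorm_nonneg : 0 ≤ D.discreteLpNorm p v :=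
  Real.rpow_nonneg (D.sum_volume_mul_abs_rpow_nonneg v) _

lemma discreteLpNorm_rpow (s : ℝ) : D.discreteLpNorm p v ^ s =
    (∑ K ∈ D.cells, (volume K).toReal * |v K| ^ p) ^ (s / p) := by
  rw [discreteLpNorm, ← Real.rpow_mul (D.sum_volume_mul_abs_rpow_nonneg v), one_div_mul_eq_div]

lemma discreteNorm_nonneg : 0 ≤ D.discreteNorm p v :=
  Real.rpow_nonneg (Finset.sum_nonneg fun _ _ => Finset.sum_nonneg fun _ _ =>
    mul_nonneg (mul_nonneg ENNReal.toReal_nonneg D.cellDist_nonneg)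
      (Real.rpow_nonneg (div_nonneg (D.jump_nonneg v) D.edgeDist_nonneg) _)) _

lemma jump_abs_rpow_le (hp : 1 ≤ p) (hσ : σ ∈ D.edges) (hK : K ∈ D.cellsOf σ) :
    D.jump (fun K => |v K| ^ p) K σ ≤
      p * ∑ L ∈ D.cellsOf σ, |v L| ^ (p - 1) * D.jump v L σ := by
  rcases D.cellsOf_eq hσ hK with hcells | ⟨L, hKL, hcells⟩
  · rw [D.jump_of_cellsOf_eq_singleton _ hcells, hcells, Finset.sum_singleton,
      D.jump_of_cellsOf_eq_singleton v hcells, abs_of_nonneg (by positivity : 0 ≤ |v K| ^ p),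
      ← Real.rpow_add_one' (abs_nonneg _) (by linarith), sub_add_cancel]
    exact le_mul_of_one_le_left (by positivity) hp
  · have hcells' : D.cellsOf σ = {L, K} := by rw [hcells, Finset.pair_comm]
    rw [D.jump_of_cellsOf_eq_pair _ hKL hcells, hcells, Finset.sum_pair hKL,
      D.jump_of_cellsOf_eq_pair v hKL hcells, D.jump_of_cellsOf_eq_pair v hKL.symm hcells',
      abs_sub_comm (v L), ← add_mul, ← mul_assoc]
    exact abs_abs_rpow_sub_abs_rpow_le hp (v K) (v L)

lemma totalVariation_abs_rpow_le (hp : 1 ≤ p) :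
    D.totalVariation (fun K => |v K| ^ p) ≤ 2 * p * ∑ K ∈ D.cells, ∑ σ ∈ D.edgesOf K,
      (μHE[d - 1] σ).toReal * (|v K| ^ (p - 1) * D.jump v K σ) := by
  let G (σ : Set (EuclideanSpace ℝ (Fin d))) : ℝ :=
    ∑ K ∈ D.cellsOf σ, |v K| ^ (p - 1) * D.jump v K σ
  have hG (σ) : 0 ≤ G σ :=
    Finset.sum_nonneg fun K _ => mul_nonneg (by positivity) (D.jump_nonneg v)
  have hjumps (σ) (hσ : σ ∈ D.edges) :
      ∑ K ∈ D.cellsOf σ, D.jump (fun K => |v K| ^ p) K σ ≤ 2 * p * G σ := by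
    have hcard : ((D.cellsOf σ).card : ℝ) ≤ 2 := by
      rcases D.card_cellsOf hσ with h | h <;> norm_num [h]
    calc ∑ K ∈ D.cellsOf σ, D.jump (fun K => |v K| ^ p) K σ
        ≤ (D.cellsOf σ).card • (p * G σ) :=
          Finset.sum_le_card_nsmul _ _ _ fun K hK => D.jump_abs_rpow_le v hp hσ hK
      _ ≤ 2 * p * G σ := by
          have := hG σ
          rw [nsmul_eq_mul, mul_assoc]
          gcongr
  calc D.totalVariation (fun K => |v K| ^ p)
      = ∑ σ ∈ D.edges, (μHE[d - 1] σ).toReal *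
          ∑ K ∈ D.cellsOf σ, D.jump (fun K => |v K| ^ p) K σ := D.totalVariation_eq_sum_edges _
    _ ≤ ∑ σ ∈ D.edges, (μHE[d - 1] σ).toReal * (2 * p * G σ) :=
        Finset.sum_le_sum fun σ hσ =>
          mul_le_mul_of_nonneg_left (hjumps σ hσ) ENNReal.toReal_nonneg
    _ = _ := by
        simp only [mul_left_comm _ (2 * p), ← Finset.mul_sum, G, ← D.sum_edges_cellsOf]

lemma sum_measure_mul_jump_le (hη : 0 < η) (hD : D.RatioBound η) :
    ∑ K ∈ D.cells, ∑ σ ∈ D.edgesOf K,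
        (μHE[d - 1] σ).toReal * (|v K| ^ (p - 1) * D.jump v K σ) ≤
      (1 + 1 / η) * ∑ K ∈ D.cells, ∑ σ ∈ D.edgesOf K, (μHE[d - 1] σ).toReal * D.cellDist K σ *
        |v K| ^ (p - 1) * (D.jump v K σ / D.edgeDist σ) := by
  simp only [Finset.mul_sum]
  refine Finset.sum_le_sum fun K hK => Finset.sum_le_sum fun σ hσ => ?_
  have hσ' := D.mem_edges_of_mem_edgesOf hK hσ
  have hratio : 1 ≤ (1 + 1 / η) * D.cellDist K σ / D.edgeDist σ :=
    (one_le_div (D.edgeDist_pos hσ')).2 (D.edgeDist_le hη hD hσ' (D.mem_cellsOf.2 ⟨hK, hσ⟩))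
  have hjump : 0 ≤ D.jump v K σ := D.jump_nonneg v
  calc (μHE[d - 1] σ).toReal * (|v K| ^ (p - 1) * D.jump v K σ)
      ≤ (μHE[d - 1] σ).toReal * (|v K| ^ (p - 1) * D.jump v K σ) *
          ((1 + 1 / η) * D.cellDist K σ / D.edgeDist σ) :=
        le_mul_of_one_le_right (by positivity) hratio
    _ = _ := by ring

lemma sum_measure_mul_cellDist_mul_le (hΩ : Bornology.IsBounded Ω) (hp : 1 ≤ p) :
    ∑ K ∈ D.cells, ∑ σ ∈ D.edgesOf K, (μHE[d - 1] σ).toReal * D.cellDist K σ *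
        |v K| ^ (p - 1) * (D.jump v K σ / D.edgeDist σ) ≤
      (d : ℝ) ^ (1 - 1 / p) * D.discreteLpNorm p v ^ (p - 1) * D.discreteNorm p v := by
  have hp0 : 0 < p := zero_lt_one.trans_le hp
  have hp1 : 0 ≤ 1 - 1 / p := sub_nonneg.2 ((div_le_one hp0).2 hp)
  have hholder := sum_mul_rpow_sub_one_mul_le (D.cells.sigma D.edgesOf) hp
    (m := fun i => (μHE[d - 1] i.2).toReal * D.cellDist i.1 i.2) (a := fun i => |v i.1|)
    (b := fun i => D.jump v i.1 i.2 / D.edgeDist i.2)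
    (fun _ => mul_nonneg ENNReal.toReal_nonneg D.cellDist_nonneg) (fun _ => abs_nonneg _)
    (fun _ => div_nonneg (D.jump_nonneg v) D.edgeDist_nonneg)
  simp only [Finset.sum_sigma, ← one_div] at hholder
  have hcones : ∑ K ∈ D.cells, ∑ σ ∈ D.edgesOf K,
      (μHE[d - 1] σ).toReal * D.cellDist K σ * |v K| ^ p ≤
        d * ∑ K ∈ D.cells, (volume K).toReal * |v K| ^ p := by
    rw [Finset.mul_sum]
    refine Finset.sum_le_sum fun K hK => ?_
    rw [← Finset.sum_mul, ← mul_assoc]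
    exact mul_le_mul_of_nonneg_right (D.sum_measure_mul_cellDist_le hΩ hK) (by positivity)
  refine hholder.trans (mul_le_mul_of_nonneg_right ?_ (D.discreteNorm_nonneg v))
  calc (∑ K ∈ D.cells, ∑ σ ∈ D.edgesOf K,
        (μHE[d - 1] σ).toReal * D.cellDist K σ * |v K| ^ p) ^ (1 - 1 / p)
      ≤ (d * ∑ K ∈ D.cells, (volume K).toReal * |v K| ^ p) ^ (1 - 1 / p) :=
        Real.rpow_le_rpow (Finset.sum_nonneg fun _ _ => Finset.sum_nonneg fun _ _ =>
          mul_nonneg (mul_nonneg ENNReal.toReal_nonneg D.cellDist_nonneg) (by positivity))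
          hcones hp1
    _ = (d : ℝ) ^ (1 - 1 / p) * D.discreteLpNorm p v ^ (p - 1) := by
        rw [Real.mul_rpow (Nat.cast_nonneg d) (D.sum_volume_mul_abs_rpow_nonneg v),
          discreteLpNorm_rpow, sub_div, div_self hp0.ne']

lemma totalVariation_abs_rpow_le_mul (hΩ : Bornology.IsBounded Ω) (hp : 1 ≤ p) (hη : 0 < η)
    (hD : D.RatioBound η) :
    D.totalVariation (fun K => |v K| ^ p) ≤ 2 * p * (1 + 1 / η) * (d : ℝ) ^ (1 - 1 / p) *
      D.discreteLpNorm p v ^ (p - 1) * D.discreteNorm p v := by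
  have : 0 < p := zero_lt_one.trans_le hp
  calc D.totalVariation (fun K => |v K| ^ p)
      ≤ 2 * p * ∑ K ∈ D.cells, ∑ σ ∈ D.edgesOf K,
          (μHE[d - 1] σ).toReal * (|v K| ^ (p - 1) * D.jump v K σ) :=
        D.totalVariation_abs_rpow_le v hp
    _ ≤ 2 * p * ((1 + 1 / η) * ((d : ℝ) ^ (1 - 1 / p) * D.discreteLpNorm p v ^ (p - 1) *
          D.discreteNorm p v)) := by
        gcongr
        refine (D.sum_measure_mul_jump_le v hη hD).trans ?_
        gcongr
        exact D.sum_measure_mul_cellDist_mul_le v hΩ hp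
    _ = _ := by ring

variable {v}

lemma cellFun_abs_rpow (hp : p ≠ 0) (x : EuclideanSpace ℝ (Fin d)) :
    D.cellFun (fun K => |v K| ^ p) x = |D.cellFun v x| ^ p :=
  D.cellFun_comp v (φ := fun t => |t| ^ p) (by simp [Real.zero_rpow hp])

lemma lintegral_enorm_cellFun (hΩ : Bornology.IsBounded Ω) :
    ∫⁻ x, ‖D.cellFun v x‖ₑ = ENNReal.ofReal (∑ K ∈ D.cells, (volume K).toReal * |v K|) := by
  have henorm (x) : ‖D.cellFun v x‖ₑ = ∑ K ∈ D.cells, K.indicator (fun _ => ‖v K‖ₑ) x := by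
    simp only [Real.enorm_eq_ofReal_abs]
    rw [← D.cellFun_comp v (φ := fun t => |t|) abs_zero, cellFun,
      ENNReal.ofReal_sum_of_nonneg fun K _ => Set.indicator_nonneg (fun _ _ => abs_nonneg _) x]
    refine Finset.sum_congr rfl fun K _ => ?_
    rw [← Function.comp_apply (f := ENNReal.ofReal),
      ← Set.indicator_comp_of_zero ENNReal.ofReal_zero]
    rfl
  simp only [henorm]
  rw [lintegral_finsetSum _ fun K hK =>
    measurable_const.indicator (D.cell_isOpen K hK).measurableSet,
    ENNReal.ofReal_sum_of_nonneg fun K _ => by positivity]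
  refine Finset.sum_congr rfl fun K hK => ?_
  rw [lintegral_indicator_const (D.cell_isOpen K hK).measurableSet,
    ENNReal.ofReal_mul ENNReal.toReal_nonneg, ENNReal.ofReal_toReal (D.volume_cell_ne_top hΩ hK),
    Real.enorm_eq_ofReal_abs, mul_comm]

lemma support_cellFun_subset : Function.support (D.cellFun v) ⊆ Ω := fun x hx => by
  by_contra hxΩ
  exact hx (D.cellFun_of_forall_notMem v fun K hK hxK => hxΩ (D.cell_subset K hK hxK))

lemma ae_eq_cellFun {u : EuclideanSpace ℝ (Fin d) → ℝ} (hu : D.HasCellValues u v) :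
    u =ᵐ[volume.restrict Ω] D.cellFun v := by
  refine ae_restrict_of_ae_restrict_of_subset subset_closure
    ((ae_restrict_iff' isClosed_closure.measurableSet).2 ?_)
  have hcells : ∀ᵐ x, ∀ K ∈ D.cells, x ∈ K → u x = v K := by
    rw [eventually_all_finset]
    exact fun K hK => (ae_restrict_iff' (D.cell_isOpen K hK).measurableSet).1 (hu K hK)
  filter_upwards [D.ae_notMem_affineSpan_edge 0, hcells] with x hxσ hxu hx
  simp only [D.closure_eq, Set.mem_iUnion, exists_prop] at hx
  obtain ⟨K, hK, hxK⟩ := hx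
  by_cases hxK' : x ∈ K
  · rw [hxu K hK hxK', D.cellFun_of_mem v hK hxK']
  · obtain ⟨σ, hσ, hmem⟩ := D.exists_mem_closure_edge hK hxK hxK'
    refine absurd (closure_edge_subset_affineSpan σ hmem) ?_
    simpa only [add_zero, SetLike.mem_coe] using hxσ σ (D.mem_edges_of_mem_edgesOf hK hσ)

section DiscretePoincare

variable [Nontrivial (EuclideanSpace ℝ (Fin d))]

lemma discreteLpNorm_rpow_le (hR : 0 ≤ R) (hΩ : Ω ⊆ Metric.ball 0 R) (hp : p ≠ 0) :
    D.discreteLpNorm p v ^ p ≤ 2 * R * D.totalVariation (fun K => |v K| ^ p) := by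
  have hb := Metric.isBounded_ball.subset hΩ
  have hle := (D.translationBound_cellFun (fun K => |v K| ^ p) hb).lintegral_enorm_le hR
    (D.support_cellFun_subset.trans hΩ)
  rw [D.lintegral_enorm_cellFun hb, ENNReal.ofReal_le_ofReal_iff
    (mul_nonneg (D.totalVariation_nonneg _) (by positivity))] at hle
  rw [discreteLpNorm_rpow, div_self hp, Real.rpow_one, mul_comm]
  refine (Finset.sum_congr rfl fun K _ => ?_).trans_le hle
  rw [abs_of_nonneg (by positivity : 0 ≤ |v K| ^ p)]

lemma discreteLpNorm_le_discreteNorm (hR : 0 ≤ R) (hΩ : Ω ⊆ Metric.ball 0 R) (hp : 1 ≤ p)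
    (hη : 0 < η) (hD : D.RatioBound η) : D.discreteLpNorm p v ≤
      2 * R * (2 * p * (1 + 1 / η) * (d : ℝ) ^ (1 - 1 / p)) * D.discreteNorm p v := by
  have hp0 : 0 < p := zero_lt_one.trans_le hp
  have hN := D.discreteNorm_nonneg (p := p) v
  refine le_of_rpow_le_mul_rpow_sub_one hp0.ne' (D.discreteLpNorm_nonneg v) (by positivity) ?_
  calc D.discreteLpNorm p v ^ p
      ≤ 2 * R * D.totalVariation (fun K => |v K| ^ p) := D.discreteLpNorm_rpow_le hR hΩ hp0.ne'
    _ ≤ 2 * R * (2 * p * (1 + 1 / η) * (d : ℝ) ^ (1 - 1 / p) *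
          D.discreteLpNorm p v ^ (p - 1) * D.discreteNorm p v) := by
        gcongr
        exact D.totalVariation_abs_rpow_le_mul v (Metric.isBounded_ball.subset hΩ) hp hη hD
    _ = _ := by ring

lemma exists_totalVariation_le (hp : 1 ≤ p) (hR : 0 < R) (hη : 0 < η) :
    ∃ B : ℝ, 0 < B ∧ ∀ Ω : Set (EuclideanSpace ℝ (Fin d)), Ω ⊆ Metric.ball 0 R →
      ∀ D : SpaceDiscretisation Ω, D.RatioBound η → ∀ v : Set (EuclideanSpace ℝ (Fin d)) → ℝ,
        D.totalVariation (fun K => |v K| ^ p) ≤ B * D.discreteNorm p v ^ p := by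
  have : 0 < p := zero_lt_one.trans_le hp
  have hd : (0 : ℝ) < d := by
    rw [← finrank_euclideanSpace_fin (𝕜 := ℝ) (n := d)]
    exact_mod_cast Module.finrank_pos
  set M : ℝ := 2 * p * (1 + 1 / η) * (d : ℝ) ^ (1 - 1 / p)
  refine ⟨M * (2 * R * M) ^ (p - 1), by positivity, fun Ω hΩ D hD v => ?_⟩
  have hN := D.discreteNorm_nonneg (p := p) v
  calc D.totalVariation (fun K => |v K| ^ p)
      ≤ M * D.discreteLpNorm p v ^ (p - 1) * D.discreteNorm p v :=
        D.totalVariation_abs_rpow_le_mul v (Metric.isBounded_ball.subset hΩ) hp hη hD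
    _ ≤ M * (2 * R * M * D.discreteNorm p v) ^ (p - 1) * D.discreteNorm p v := by
        gcongr
        · exact D.discreteLpNorm_nonneg v
        · exact D.discreteLpNorm_le_discreteNorm hR.le hΩ hp hη hD
    _ = M * (2 * R * M) ^ (p - 1) * (D.discreteNorm p v ^ (p - 1) * D.discreteNorm p v) := by
        rw [Real.mul_rpow (by positivity) hN]
        ring
    _ = M * (2 * R * M) ^ (p - 1) * D.discreteNorm p v ^ p := by
        rw [← Real.rpow_add_one' hN (by linarith), sub_add_cancel]

end DiscretePoincare

lemma eLpNorm_cellFun (hp : p ≠ 0) (hq : 0 < q) :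
    eLpNorm (D.cellFun v) (ENNReal.ofReal q) volume =
      (∫⁻ x, ENNReal.ofReal (|D.cellFun (fun K => |v K| ^ p) x| ^ (q / p))) ^ (1 / q) := by
  rw [eLpNorm_eq_lintegral_rpow_enorm_toReal (ENNReal.ofReal_pos.2 hq).ne' ENNReal.ofReal_ne_top,
    ENNReal.toReal_ofReal hq.le]
  congr 1
  refine lintegral_congr fun x => ?_
  rw [D.cellFun_abs_rpow hp, abs_of_nonneg (by positivity : 0 ≤ |D.cellFun v x| ^ p),
    ← Real.rpow_mul (abs_nonneg _), mul_div_cancel₀ _ hp, Real.enorm_eq_ofReal_abs,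
    ENNReal.ofReal_rpow_of_nonneg (abs_nonneg _) hq.le]

end DiscreteNorms

end SpaceDiscretisation

theorem lemma5p3_general {d : ℕ} (hd : 1 ≤ d) {p q R η : ℝ} (hp : 1 ≤ p) (hq : 0 < q)
    (hqp : q < p * (1 + (d : ℝ)⁻¹)) (hR : 0 < R) (hη : 0 < η) :
    ∃ C : ℝ, 0 < C ∧ ∀ Ω : Set (EuclideanSpace ℝ (Fin d)), Ω ⊆ Metric.ball 0 R →
      ∀ D : SpaceDiscretisation Ω, D.RatioBound η →
      ∀ (u : EuclideanSpace ℝ (Fin d) → ℝ) (v : Set (EuclideanSpace ℝ (Fin d)) → ℝ),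
        D.HasCellValues u v →
        eLpNorm u (ENNReal.ofReal q) (volume.restrict Ω) ≤
          ENNReal.ofReal (C * D.discreteNorm p v) := by
  have : Nonempty (Fin d) := ⟨⟨0, hd⟩⟩
  have hp0 : 0 < p := zero_lt_one.trans_le hp
  have hr : q / p < 1 + (Module.finrank ℝ (EuclideanSpace ℝ (Fin d)) : ℝ)⁻¹ := by
    rwa [finrank_euclideanSpace_fin, div_lt_iff₀' hp0]
  obtain ⟨B, hB, hvar⟩ := SpaceDiscretisation.exists_totalVariation_le (d := d) hp hR hη
  obtain ⟨C, hC, hgain⟩ := TranslationBound.exists_lintegral_rpow_le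
    (volume : Measure (EuclideanSpace ℝ (Fin d))) (div_pos hq hp0) hr hR
  refine ⟨(C * B ^ (q / p)) ^ (1 / q), by positivity, fun Ω hΩ D hD u v hu => ?_⟩
  have hN := D.discreteNorm_nonneg (p := p) v
  have hT := D.totalVariation_nonneg fun K => |v K| ^ p
  calc eLpNorm u (ENNReal.ofReal q) (volume.restrict Ω)
      = eLpNorm (D.cellFun v) (ENNReal.ofReal q) (volume.restrict Ω) :=
        eLpNorm_congr_ae (D.ae_eq_cellFun hu)
    _ ≤ eLpNorm (D.cellFun v) (ENNReal.ofReal q) volume :=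
        eLpNorm_mono_measure _ Measure.restrict_le_self
    _ = (∫⁻ x, ENNReal.ofReal (|D.cellFun (fun K => |v K| ^ p) x| ^ (q / p))) ^ (1 / q) :=
        D.eLpNorm_cellFun hp0.ne' hq
    _ ≤ ENNReal.ofReal (C * D.totalVariation (fun K => |v K| ^ p) ^ (q / p)) ^ (1 / q) := by
        gcongr
        exact hgain _ _ (D.translationBound_cellFun _ (Metric.isBounded_ball.subset hΩ))
          (D.measurable_cellFun _) hT (D.support_cellFun_subset.trans hΩ)
    _ ≤ ENNReal.ofReal (C * (B * D.discreteNorm p v ^ p) ^ (q / p)) ^ (1 / q) := by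
        gcongr
        exact hvar Ω hΩ D hD v
    _ = ENNReal.ofReal ((C * B ^ (q / p)) ^ (1 / q) * D.discreteNorm p v) := by
        rw [ENNReal.ofReal_rpow_of_nonneg (by positivity) (by positivity),
          Real.mul_rpow hB.le (by positivity), ← mul_assoc,
          Real.mul_rpow (by positivity) (by positivity), ← Real.rpow_mul hN,
          mul_div_cancel₀ _ hp0.ne', ← Real.rpow_mul hN, mul_one_div_cancel hq.ne', Real.rpow_one]

theorem lemma5p3 (d : ℕ) (hd : 1 ≤ d) (p : ℝ) (hp : 1 ≤ p) :
    ∃ q : ℝ, p < q ∧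
      ∀ Ω : Set (EuclideanSpace ℝ (Fin d)), IsPolyhedralDomain Ω →
      ∀ η : ℝ, 0 < η →
      ∃ C : ℝ, 0 < C ∧
        ∀ D : SpaceDiscretisation Ω, D.RatioBound η →
        ∀ (u : EuclideanSpace ℝ (Fin d) → ℝ) (v : Set (EuclideanSpace ℝ (Fin d)) → ℝ),
          D.HasCellValues u v →
          eLpNorm u (ENNReal.ofReal q) (volume.restrict Ω) ≤
            ENNReal.ofReal (C * D.discreteNorm p v) := by
  have hp0 : 0 < p := zero_lt_one.trans_le hp
  have hexponent : 1 < 1 + (d : ℝ)⁻¹ := lt_add_of_pos_right 1 (by positivity)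
  obtain ⟨q, hpq, hq⟩ := exists_between (lt_mul_of_one_lt_right hp0 hexponent)
  refine ⟨q, hpq, fun Ω hΩ η hη => ?_⟩
  obtain ⟨R, hR, hΩR⟩ := hΩ.isBounded.subset_ball_lt 0 0
  obtain ⟨C, hC, hbound⟩ := lemma5p3_general hd hp (hp0.trans hpq) hq hR hη
  exact ⟨C, hC, hbound Ω hΩR⟩
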